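/- **Setting.** Let $d\ge 1$ and $f:\mathbf R^d\to\mathbf R$ be bounded. Put $\Delta_h^1f(x)=f(x+h)-f(x)$, $\Delta_h^{M}=\Delta_h^{M-1}\Delta_h^1$ and $\omega_f^M(r)=\sup_{|h|\le r}\sup_{x}|\Delta_h^Mf(x)|$. For $\alpha\ge 0$ let $M_\alpha=\lfloor\alpha\rfloor+1$. The function $f$ is *uniformly Hölderian* if for some $\alpha>0$ there are $C,R>0$ with $\omega_f^{M_\alpha}(r)\le C r^\alpha$ for all $0<r\le R$. It belongs to $UI^\alpha(\mathbf R^d)$ ($\alpha\ge0$) if there are $C,R>0$ with $\omega_f^{M_\alpha}(r)\ge C r^\alpha$ for all $0<r\le R$. Its upper global Hölder exponent is $$\overline{\mathcal H}_f=\inf\{\alpha\ge 0: f\in UI^\alpha(\mathbf R^d)\}\in[0,\infty]\qquad(\inf\emptyset=\infty).$$ Let $\gamma\in\mathbf N\cup\{\infty\}$ and let $\phi,\psi:\mathbf R\to\mathbf R$ be of class $C^\gamma$ such that all their derivatives of order $\le\gamma$ have fast decay (faster than any power). For $i\in\{0,1\}^d$ let $\psi^{(i)}$ be the tensor product whose $m$-th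 factor is $\psi(x_m)$ if $i_m=1$ and $\phi(x_m)$ if $i_m=0$, and suppose that the functions $\psi^{(0)}(x-k)$ and $2^{jd/2}\psi^{(i)}(2^jx-k)$ ($i\ne 0$, $j\ge 0$, $k\in\mathbf Z^d$) form an orthonormal basis of $L^2(\mathbf R^d)$. Put $$c^{(i)}_{j,k}=2^{dj}\int_{\mathbf R^d}f(x)\,\psi^{(i)}(2^jx-k)\,dx,\qquad \|c_j\|_\infty=\sup_{i\neq0,\;k\in\mathbf Z^d}|c^{(i)}_{j,k}|\quad(j\ge0),$$ and $\log_2 0=-\infty$. **Corollary.** Let $f$ be uniformly Hölderian. 1. If $\overline{\mathcal H}_f<\infty$, $M=\lfloor\overline{\mathcal H}_f\rfloor+1$ and $\gamma\ge M$ (equivalently $\gamma>\overline{\mathcal H}_f$), then $$\overline{\mathcal H}_f=\limsup_{j\to\infty}\frac{\log_2\max\Bigl(\sup_{\ell\ge j}\|c_\ell\|_\infty,\;2^{-jM}\sup_{0\le\ell\le j}2^{\ell M}\|c_\ell\|_\infty\Bigr)}{-j}.$$ 2. If $\overline{\mathcal H}_f=\infty$ and $\gamma=\infty$, then the formula holds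 with $M=\infty$, in the sense that $$\limsup_{j\to\infty}\frac{\log_2\sup_{\ell\ge j}\|c_\ell\|_\infty}{-j}=\infty .$$ -/

import Mathlib

open MeasureTheory Filter
open scoped ENNReal

noncomputable section

namespace UpperHolder

/-- The `M`-modulus of smoothness `ω_f^M(r) = sup_{|h| ≤ r} sup_x |Δ_h^M f(x)|`, as an extended
nonnegative number (it is finite when `f` is bounded). -/
def modulus {d : ℕ} (M : ℕ) (f : EuclideanSpace ℝ (Fin d) → ℝ) (r : ℝ) : ℝ≥0∞ :=
  ⨆ (h : EuclideanSpace ℝ (Fin d)) (_ : ‖h‖ ≤ r) (x : EuclideanSpace ℝ (Fin d)),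
    ‖((fwdDiff h)^[M] f) x‖ₑ

/-- `f` is bounded on `ℝ^d`. -/
def IsBoundedFun {d : ℕ} (f : EuclideanSpace ℝ (Fin d) → ℝ) : Prop :=
  ∃ B : ℝ, ∀ x, |f x| ≤ B

/-- `f ∈ C^α(ℝ^d)`: `f` is bounded and `ω_f^M(r) ≤ C r^α` for all small `r`, `M = ⌊α⌋ + 1`. -/
def MemHolder {d : ℕ} (α : ℝ) (f : EuclideanSpace ℝ (Fin d) → ℝ) : Prop :=
  IsBoundedFun f ∧ ∃ C R : ℝ, 0 < C ∧ 0 < R ∧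
    ∀ r : ℝ, 0 < r → r ≤ R → modulus (⌊α⌋₊ + 1) f r ≤ ENNReal.ofReal (C * r ^ α)

/-- `f` is uniformly Hölderian: `f ∈ C^α(ℝ^d)` for some `α > 0`. -/
def UniformlyHolderian {d : ℕ} (f : EuclideanSpace ℝ (Fin d) → ℝ) : Prop :=
  ∃ α : ℝ, 0 < α ∧ MemHolder α f

/-- `f ∈ UI^α(ℝ^d)`: `f` is bounded and `ω_f^M(r) ≥ C r^α` for all small `r`, `M = ⌊α⌋ + 1`. -/
def MemUI {d : ℕ} (α : ℝ) (f : EuclideanSpace ℝ (Fin d) → ℝ) : Prop :=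
  IsBoundedFun f ∧ ∃ C R : ℝ, 0 < C ∧ 0 < R ∧
    ∀ r : ℝ, 0 < r → r ≤ R → ENNReal.ofReal (C * r ^ α) ≤ modulus (⌊α⌋₊ + 1) f r

/-- The upper global Hölder exponent `inf {α ≥ 0 : f ∈ UI^α(ℝ^d)}`; it is `⊤` when `f` belongs to
no `UI^α(ℝ^d)`. -/
def upperExponent {d : ℕ} (f : EuclideanSpace ℝ (Fin d) → ℝ) : EReal :=
  ⨅ (α : ℝ) (_ : 0 ≤ α ∧ MemUI α f), (α : EReal)

/-- `g` is of class `C^γ` and all its derivatives of order at most `γ` have fast decay. -/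
def RegularFastDecay (γ : ℕ∞) (g : ℝ → ℝ) : Prop :=
  ContDiff ℝ (γ : WithTop ℕ∞) g ∧
    ∀ n : ℕ, (n : ℕ∞) ≤ γ → ∀ N : ℕ, ∃ C : ℝ, ∀ x : ℝ,
      |iteratedDeriv n g x| * (1 + |x|) ^ N ≤ C

/-- The tensor product of `d` factors, the factor number `m` being `ψ` if `i m` is true and `φ`
otherwise. -/
def tensor {d : ℕ} (φ ψ : ℝ → ℝ) (i : Fin d → Bool) (y : Fin d → ℝ) : ℝ :=
  ∏ m, (if i m then ψ (y m) else φ (y m))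

/-- The function `x ↦ ψ^{(i)}(2^j x - k)`. For `i = 0` and `j = 0` it is the translate by `k` of
the scaling function of `ℝ^d`. -/
def waveletFun {d : ℕ} (φ ψ : ℝ → ℝ) (i : Fin d → Bool) (j : ℕ) (k : Fin d → ℤ)
    (x : EuclideanSpace ℝ (Fin d)) : ℝ :=
  tensor φ ψ i (fun m => (2 : ℝ) ^ j * x m - (k m : ℝ))

/-- The types of the `2^d - 1` wavelets: `{0,1}^d` without the origin. -/
abbrev WType (d : ℕ) : Type := {i : Fin d → Bool // i ≠ fun _ => false}

/-- The wavelet system normalized in `L²`: the functions `φ(x - k)` (left summand) and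
`2^{jd/2} ψ^{(i)}(2^j x - k)`, `j ≥ 0` (right summand). -/
def waveletSystem (d : ℕ) (φ ψ : ℝ → ℝ) :
    (Fin d → ℤ) ⊕ (WType d × ℕ × (Fin d → ℤ)) → EuclideanSpace ℝ (Fin d) → ℝ
  | Sum.inl k => fun x => waveletFun φ ψ (fun _ => false) 0 k x
  | Sum.inr (i, j, k) => fun x => √((2 : ℝ) ^ (d * j)) * waveletFun φ ψ i.1 j k x

/-- `φ, ψ : ℝ → ℝ` generate a tensor product wavelet basis of `L²(ℝ^d)` of regularity `γ`. -/
structure IsWaveletBasis (d : ℕ) (γ : ℕ∞) (φ ψ : ℝ → ℝ) : Prop where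
  regular_scaling : RegularFastDecay γ φ
  regular_wavelet : RegularFastDecay γ ψ
  basis : ∃ b : HilbertBasis ((Fin d → ℤ) ⊕ (WType d × ℕ × (Fin d → ℤ))) ℝ
      (Lp ℝ 2 (volume : Measure (EuclideanSpace ℝ (Fin d)))),
    ∀ n, (b n : EuclideanSpace ℝ (Fin d) → ℝ) =ᵐ[volume] waveletSystem d φ ψ n

/-- The wavelet coefficient `c_{j,k}^{(i)} = 2^{dj} ∫ f(x) ψ^{(i)}(2^j x - k) dx`. -/
def coeff {d : ℕ} (φ ψ : ℝ → ℝ) (f : EuclideanSpace ℝ (Fin d) → ℝ)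
    (i : WType d) (j : ℕ) (k : Fin d → ℤ) : ℝ :=
  (2 : ℝ) ^ (d * j) * ∫ x, f x * waveletFun φ ψ i.1 j k x

/-- `‖c_j‖_∞ = sup_{i,k} |c_{j,k}^{(i)}|`. -/
def coeffSup {d : ℕ} (φ ψ : ℝ → ℝ) (f : EuclideanSpace ℝ (Fin d) → ℝ) (j : ℕ) : ℝ≥0∞ :=
  ⨆ (i : WType d) (k : Fin d → ℤ), ‖coeff φ ψ f i j k‖ₑ

/-- `max (sup_{ℓ ≥ j} ‖c_ℓ‖_∞, 2^{-jM} sup_{0 ≤ ℓ ≤ j} 2^{ℓM} ‖c_ℓ‖_∞)`. -/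
def coeffMax {d : ℕ} (φ ψ : ℝ → ℝ) (f : EuclideanSpace ℝ (Fin d) → ℝ) (M j : ℕ) : ℝ≥0∞ :=
  max (⨆ (l : ℕ) (_ : j ≤ l), coeffSup φ ψ f l)
    (((2 : ℝ≥0∞) ^ (j * M))⁻¹ * ⨆ (l : ℕ) (_ : l ≤ j), (2 : ℝ≥0∞) ^ (l * M) * coeffSup φ ψ f l)

/-- Base two logarithm with `log₂ 0 = -∞` and `log₂ ∞ = ∞`. -/
def log2 (a : ℝ≥0∞) : EReal := ENNReal.log a / (Real.log 2 : EReal)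

end UpperHolder

end

/-!
# The upper global Hölder exponent from wavelet coefficients

On the dyadic scales `2⁻ʲ`, the modulus of smoothness `ω^M` of a uniformly Hölderian function and
the quantity `coeffMax` have the same upper rate of decay, because each controls the other up to
factors that are subexponential in `j`, and up to a remainder `O(2^{-jM})` which is negligible
against any rate below `M`. The exponent is read off the modulus by definition.

* *Coefficients are at most the modulus*, `‖c_j‖ ≤ C ω^M(2⁻ʲ)` (`IsWaveletBasis.exists_coeffSup_le`,
  then `IsWaveletBasis.exists_coeffMax_le`). Orthogonality of `ψ` to its own fine dilates located
  at a fixed dyadic point forces `ψ` to be the `M`-th derivative of a rapidly decreasing function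
  (`IsWaveletBasis.exists_primitives`); the tensor structure reduces this to dimension one. To pair
  `f` with such a function, `f` is replaced by a combination of its iterated Steklov averages
  along one coordinate: the error is an average of differences of order `M`, and averages turn the
  derivatives on the other factor into differences of order `M` of `f`
  (`abs_integral_mul_le_of_primitives`).

* *The modulus is at most the coefficients*, with weights `min(1, (2ʲ‖h‖)^M)`
  (`IsWaveletBasis.exists_enorm_fwdDiff_le`, then `IsWaveletBasis.exists_modulus_le`). No pointwise
  reconstruction of `f` is used. The difference `Δ_h^M f` is tested against `C¹` functions with
  compact support, whose wavelet expansions converge absolutely in `L¹`, so that Parseval's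
  identity holds for the bounded function `f` (`enorm_integral_mul_le_tsum`). Moving the difference
  onto the wavelets, where it is small by their regularity, gives the bound.

* The infinitely many fine scales are summed with `‖c_l‖ ≤ C 2^{-lβ}` for some `β > 0`. The order
  of the modulus in the definition of uniform Hölder regularity may exceed the regularity of the
  wavelets, so Marchaud's inequality (`exists_holder_descend`) is used to pass to first differences,
  which also yields the continuity of `f`.
-/

noncomputable section

namespace UpperHolder

section

/-! ### Rapidly decreasing functions of one variable -/

/-- A continuous function on the line that decreases faster than any power of `|x|`. -/
structure FastDecay (g : ℝ → ℝ) : Prop where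
  cont : Continuous g
  decay : ∀ N : ℕ, ∃ C : ℝ, ∀ x : ℝ, |g x| * (1 + |x|) ^ N ≤ C

lemma RegularFastDecay.fastDecay {γ : ℕ∞} {g : ℝ → ℝ} (h : RegularFastDecay γ g) :
    FastDecay g :=
  ⟨h.1.continuous, fun N => by simpa using h.2 0 (by simp) N⟩

lemma RegularFastDecay.fastDecay_iteratedDeriv {γ : ℕ∞} {g : ℝ → ℝ} (h : RegularFastDecay γ g)
    {n : ℕ} (hn : (n : ℕ∞) ≤ γ) : FastDecay (iteratedDeriv n g) :=
  ⟨h.1.continuous_iteratedDeriv n (by exact_mod_cast hn), h.2 n hn⟩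

namespace FastDecay

variable {g : ℝ → ℝ}

lemma const_nonneg {C : ℝ} {N : ℕ} (h : ∀ x : ℝ, |g x| * (1 + |x|) ^ N ≤ C) : 0 ≤ C :=
  le_trans (by positivity) (h 0)

lemma bounded (hg : FastDecay g) : ∃ C, ∀ x, |g x| ≤ C := by
  obtain ⟨C, hC⟩ := hg.decay 0
  exact ⟨C, fun x => by simpa using hC x⟩

lemma integrable (hg : FastDecay g) : Integrable g := by
  obtain ⟨C, hC⟩ := hg.decay 2
  have hC0 := const_nonneg hC
  refine (integrable_inv_one_add_sq.const_mul C).mono' hg.cont.aestronglyMeasurable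
    (Eventually.of_forall fun x => ?_)
  rw [← div_eq_mul_inv, le_div_iff₀ (by positivity), Real.norm_eq_abs]
  refine le_trans ?_ (hC x)
  gcongr
  nlinarith [abs_nonneg x, sq_abs x]

lemma abs (hg : FastDecay g) : FastDecay fun x => |g x| :=
  ⟨hg.cont.abs, fun N => by simpa using hg.decay N⟩

lemma mul_one_add_abs_pow (hg : FastDecay g) (l : ℕ) : FastDecay fun x => g x * (1 + |x|) ^ l := by
  refine ⟨hg.cont.mul (by fun_prop), fun N => ?_⟩
  obtain ⟨C, hC⟩ := hg.decay (l + N)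
  refine ⟨C, fun x => le_trans (le_of_eq ?_) (hC x)⟩
  rw [abs_mul, abs_of_nonneg (by positivity : 0 ≤ (1 + |x|) ^ l), pow_add, mul_assoc]

/-- The primitive of a rapidly decreasing function of integral zero is rapidly decreasing. -/
lemma exists_primitive (hg : FastDecay g) (h0 : ∫ x, g x = 0) :
    ∃ G : ℝ → ℝ, FastDecay G ∧ ∀ x, HasDerivAt G (g x) x := by
  have hint := hg.integrable
  have hder : ∀ x, HasDerivAt (fun x => ∫ t in Set.Iic x, g t) (g x) x := by
    intro x
    have h1 : (fun x => ∫ t in Set.Iic x, g t)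
        = fun x => (∫ t in Set.Iic (0:ℝ), g t) + ∫ t in (0:ℝ)..x, g t := by
      ext y
      rw [← intervalIntegral.integral_Iic_sub_Iic hint.integrableOn hint.integrableOn]
      ring
    rw [h1]
    exact (intervalIntegral.integral_hasDerivAt_right (hint.intervalIntegrable)
      hg.cont.aestronglyMeasurable.stronglyMeasurableAtFilter hg.cont.continuousAt).const_add _
  refine ⟨fun x => ∫ t in Set.Iic x, g t,
    ⟨continuous_iff_continuousAt.2 fun x => (hder x).continuousAt, fun N => ?_⟩, hder⟩
  have hN := (hg.mul_one_add_abs_pow N).abs.integrable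
  refine ⟨∫ t, |g t * (1 + |t|) ^ N|, fun x => ?_⟩
  have key : ∀ s : Set ℝ, MeasurableSet s → (∀ t ∈ s, |x| ≤ |t|) →
      |∫ t in s, g t| * (1 + |x|) ^ N ≤ ∫ t, |g t * (1 + |t|) ^ N| := by
    intro s hs hst
    calc |∫ t in s, g t| * (1 + |x|) ^ N
        ≤ (∫ t in s, |g t|) * (1 + |x|) ^ N := by
          gcongr; exact abs_integral_le_integral_abs
      _ = ∫ t in s, |g t| * (1 + |x|) ^ N := (integral_mul_const _ _).symm
      _ ≤ ∫ t in s, |g t * (1 + |t|) ^ N| := by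
          refine setIntegral_mono_on (hint.abs.mul_const _).integrableOn hN.integrableOn hs
            fun t ht => ?_
          rw [abs_mul, abs_of_nonneg (by positivity : 0 ≤ (1 + |t|) ^ N)]
          have := hst t ht
          exact mul_le_mul_of_nonneg_left (pow_le_pow_left₀ (by positivity) (by linarith) N)
            (abs_nonneg _)
      _ ≤ ∫ t, |g t * (1 + |t|) ^ N| :=
          setIntegral_le_integral hN (Eventually.of_forall fun t => abs_nonneg _)
  rcases le_total x 0 with hx | hx
  · refine key (Set.Iic x) measurableSet_Iic fun t ht => ?_
    have ht : t ≤ x := ht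
    rw [abs_of_nonpos hx, abs_of_nonpos (ht.trans hx)]
    linarith
  · have h2 : ∫ t in Set.Iic x, g t = -∫ t in Set.Ioi x, g t := by
      have := intervalIntegral.integral_Iic_add_Ioi (b := x) hint.integrableOn hint.integrableOn
      linarith
    show |∫ t in Set.Iic x, g t| * _ ≤ _
    rw [h2, abs_neg]
    refine key (Set.Ioi x) measurableSet_Ioi fun t ht => ?_
    have ht : x < t := ht
    rw [abs_of_nonneg hx, abs_of_nonneg (hx.trans ht.le)]
    linarith

lemma eq_zero_of_const (hg : FastDecay g) {c : ℝ} (hc : ∀ x, g x = c) : c = 0 := by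
  obtain ⟨C, hC⟩ := hg.decay 1
  by_contra h
  have h1 := hC (C / (|c|))
  have h2 : 0 < |c| := abs_pos.2 h
  have h3 : C ≤ |c| * |C / (|c|)| := by
    rw [abs_div, abs_abs, mul_div_cancel₀ _ h2.ne']
    exact le_abs_self C
  rw [hc, pow_one] at h1
  nlinarith

end FastDecay

/-! ### Sums over the integer lattice -/

lemma tsum_pi_prod {d : ℕ} (a : Fin d → ℤ → ℝ≥0∞) :
    ∑' k : Fin d → ℤ, ∏ m, a m (k m) = ∏ m, ∑' n, a m n := by
  induction d with
  | zero => simp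
  | succ d ih =>
    rw [← (Fin.consEquiv fun _ => ℤ).tsum_eq, ENNReal.tsum_prod']
    simp only [Fin.consEquiv_apply, Fin.prod_univ_succ, Fin.cons_zero, Fin.cons_succ]
    simp_rw [ENNReal.tsum_mul_left, ih fun m => a m.succ, ENNReal.tsum_mul_right]

lemma summable_int_one_add_abs_sq : Summable fun n : ℤ => ((1 + |(n : ℝ)|) ^ 2)⁻¹ := by
  have h : Summable fun n : ℕ => ((1 + |((n : ℤ) : ℝ)|) ^ 2)⁻¹ := by
    have h1 := (summable_nat_add_iff 1).2 (Real.summable_nat_pow_inv.2 (by norm_num : 1 < 2))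
    refine h1.congr fun n => ?_
    simp [add_comm]
  refine Summable.of_nat_of_neg h ?_
  simpa using h

/-- The sum of `(1 + |t - n|)⁻²` over the integers is bounded independently of `t`. -/
lemma exists_tsum_int_le : ∃ C : ℝ≥0∞, C ≠ ⊤ ∧ ∀ t : ℝ,
    ∑' n : ℤ, ENNReal.ofReal ((1 + |t - n|) ^ 2)⁻¹ ≤ C := by
  refine ⟨4 * ∑' n : ℤ, ENNReal.ofReal ((1 + |(n : ℝ)|) ^ 2)⁻¹,
    ENNReal.mul_ne_top (by simp) ?_, fun t => ?_⟩
  · rw [← ENNReal.ofReal_tsum_of_nonneg (fun n => by positivity) summable_int_one_add_abs_sq]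
    exact ENNReal.ofReal_ne_top
  · rw [← (Equiv.addLeft ⌊t⌋).tsum_eq, ← ENNReal.tsum_mul_left]
    refine ENNReal.tsum_le_tsum fun n => ?_
    rw [← ENNReal.ofReal_ofNat, ← ENNReal.ofReal_mul (by norm_num)]
    refine ENNReal.ofReal_le_ofReal ?_
    have h1 : |(n : ℝ)| ≤ |t - ((Equiv.addLeft ⌊t⌋) n : ℤ)| + 1 := by
      have h2 : (n : ℝ) = Int.fract t - (t - ((Equiv.addLeft ⌊t⌋) n : ℤ)) := by
        simp only [Equiv.coe_addLeft, Int.cast_add, Int.fract]; ring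
      calc |(n : ℝ)| ≤ |Int.fract t| + |t - ((Equiv.addLeft ⌊t⌋) n : ℤ)| := by
            conv_lhs => rw [h2]
            exact abs_sub _ _
        _ ≤ _ := by
            rw [abs_of_nonneg (Int.fract_nonneg t)]
            linarith [Int.fract_lt_one t]
    rw [← div_eq_mul_inv, le_div_iff₀ (by positivity), ← div_eq_inv_mul,
      div_le_iff₀ (by positivity)]
    have h3 : 1 + |(n : ℝ)| ≤ 2 * (1 + |t - ((Equiv.addLeft ⌊t⌋) n : ℤ)|) := by
      linarith [abs_nonneg (t - ((Equiv.addLeft ⌊t⌋) n : ℤ))]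
    calc (1 + |(n : ℝ)|) ^ 2 ≤ (2 * (1 + |t - ((Equiv.addLeft ⌊t⌋) n : ℤ)|)) ^ 2 := by gcongr
      _ = _ := by ring

/-- A bound by the weight `∏ (1 + |y m|)⁻²` gives a bounded sum over the lattice translates. -/
lemma exists_tsum_lattice_le (d : ℕ) : ∃ C : ℝ≥0∞, C ≠ ⊤ ∧ ∀ y : Fin d → ℝ,
    ∑' k : Fin d → ℤ, ENNReal.ofReal (∏ m, ((1 + |y m - k m|) ^ 2)⁻¹) ≤ C := by
  obtain ⟨C, hC, h⟩ := exists_tsum_int_le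
  refine ⟨C ^ d, ENNReal.pow_ne_top hC, fun y => ?_⟩
  have h1 : ∀ k : Fin d → ℤ, ENNReal.ofReal (∏ m, ((1 + |y m - k m|) ^ 2)⁻¹)
      = ∏ m, ENNReal.ofReal ((1 + |y m - k m|) ^ 2)⁻¹ := fun k =>
    ENNReal.ofReal_prod_of_nonneg fun m _ => by positivity
  simp_rw [h1]
  rw [tsum_pi_prod fun m n => ENNReal.ofReal ((1 + |y m - n|) ^ 2)⁻¹]
  calc _ ≤ ∏ _m : Fin d, C := Finset.prod_le_prod' fun m _ => h (y m)
    _ = C ^ d := by simp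

/-! ### Dilated and translated tensor products -/

/-- The function `x ↦ ∏ₘ qₘ(a xₘ - kₘ)`. -/
def prodDil {d : ℕ} (q : Fin d → ℝ → ℝ) (a : ℝ) (k : Fin d → ℤ)
    (x : EuclideanSpace ℝ (Fin d)) : ℝ :=
  ∏ m, q m (a * x m - k m)

lemma integral_prod_coord {d : ℕ} (g : Fin d → ℝ → ℝ) :
    ∫ x : EuclideanSpace ℝ (Fin d), ∏ m, g m (x m) = ∏ m, ∫ t, g m t := by
  rw [← (PiLp.volume_preserving_toLp (Fin d)).integral_comp
    (MeasurableEquiv.toLp 2 (Fin d → ℝ)).measurableEmbedding]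
  exact integral_fintype_prod_volume_eq_prod g

lemma integrable_prod_coord {d : ℕ} {g : Fin d → ℝ → ℝ} (hg : ∀ m, Integrable (g m)) :
    Integrable fun x : EuclideanSpace ℝ (Fin d) => ∏ m, g m (x m) := by
  rw [← (PiLp.volume_preserving_toLp (Fin d)).integrable_comp_emb
    (MeasurableEquiv.toLp 2 (Fin d → ℝ)).measurableEmbedding]
  exact Integrable.fintype_prod hg

lemma integral_comp_dil (g : ℝ → ℝ) {a : ℝ} (ha : 0 < a) (k : ℝ) :
    ∫ t, g (a * t - k) = a⁻¹ * ∫ t, g t := by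
  rw [Measure.integral_comp_mul_left (fun t => g (t - k)) a, integral_sub_right_eq_self,
    abs_of_pos (inv_pos.2 ha), smul_eq_mul]

section prodDil

variable {d : ℕ} {q : Fin d → ℝ → ℝ}

lemma continuous_prodDil (hq : ∀ m, FastDecay (q m)) (a : ℝ) (k : Fin d → ℤ) :
    Continuous (prodDil q a k) := by
  have := fun m => (hq m).cont
  unfold prodDil
  fun_prop

lemma integrable_prodDil (hq : ∀ m, FastDecay (q m)) {a : ℝ} (ha : 0 < a) (k : Fin d → ℤ) :
    Integrable (prodDil q a k) := by
  refine integrable_prod_coord (g := fun m t => q m (a * t - k m)) fun m => ?_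
  exact ((hq m).integrable.comp_sub_right (k m : ℝ)).comp_mul_left' ha.ne'

lemma integral_abs_prodDil {a : ℝ} (ha : 0 < a) (k : Fin d → ℤ) :
    ∫ x, |prodDil q a k x| = (a ^ d)⁻¹ * ∏ m, ∫ t, |q m t| := by
  simp only [prodDil, Finset.abs_prod]
  rw [integral_prod_coord fun m t => |q m (a * t - k m)|]
  have h1 : ∀ m, ∫ t, |q m (a * t - k m)| = a⁻¹ * ∫ t, |q m t| := fun m =>
    integral_comp_dil (fun t => |q m t|) ha (k m)
  simp_rw [h1]
  rw [Finset.prod_mul_distrib]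
  simp

lemma exists_tsum_prodDil_le (hq : ∀ m, FastDecay (q m)) : ∃ C : ℝ≥0∞, C ≠ ⊤ ∧
    ∀ (a : ℝ) (x : EuclideanSpace ℝ (Fin d)), ∑' k, ‖prodDil q a k x‖ₑ ≤ C := by
  obtain ⟨C, hC, h⟩ := exists_tsum_lattice_le d
  choose D hD using fun m => (hq m).decay 2
  have hD0 : ∀ m, 0 ≤ D m := fun m => FastDecay.const_nonneg (hD m)
  refine ⟨ENNReal.ofReal (∏ m, D m) * C, ENNReal.mul_ne_top ENNReal.ofReal_ne_top hC,
    fun a x => ?_⟩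
  refine le_trans ?_ (mul_le_mul_right (h fun m => a * x m) _)
  rw [← ENNReal.tsum_mul_left]
  refine ENNReal.tsum_le_tsum fun k => ?_
  rw [← ENNReal.ofReal_mul (Finset.prod_nonneg fun m _ => hD0 m), ← Finset.prod_mul_distrib,
    Real.enorm_eq_ofReal_abs, prodDil, Finset.abs_prod]
  refine ENNReal.ofReal_le_ofReal (Finset.prod_le_prod (fun m _ => abs_nonneg _) fun m _ => ?_)
  rw [← div_eq_mul_inv, le_div_iff₀ (by positivity)]
  exact hD m _

/-- Replacing the factor number `m` by its primitive integrates `prodDil` along `a⁻¹ eₘ`. -/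
lemma hasDerivAt_prodDil_update {m : Fin d} {p p' : ℝ → ℝ} (hp : ∀ t, HasDerivAt p (p' t) t)
    {a : ℝ} (ha : 0 < a) (k : Fin d → ℤ) (x : EuclideanSpace ℝ (Fin d)) (t : ℝ) :
    HasDerivAt (fun t : ℝ => prodDil (Function.update q m p) a k
        (x + t • EuclideanSpace.single m a⁻¹))
      (prodDil (Function.update q m p') a k (x + t • EuclideanSpace.single m a⁻¹)) t := by
  have hpr : ∀ (r : ℝ → ℝ) (t : ℝ), prodDil (Function.update q m r) a k
      (x + t • EuclideanSpace.single m a⁻¹) =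
      r (a * x m - k m + t) * ∏ n ∈ Finset.univ.erase m, q n (a * x n - k n) := by
    intro r t
    rw [prodDil, ← Finset.mul_prod_erase _ _ (Finset.mem_univ m)]
    congr 1
    · simp only [Function.update_self, PiLp.add_apply, PiLp.smul_apply, smul_eq_mul,
        PiLp.single_apply, if_true]
      congr 1
      field_simp
      ring
    · refine Finset.prod_congr rfl fun n hn => ?_
      have hne : n ≠ m := Finset.ne_of_mem_erase hn
      simp [hne]
  simp_rw [hpr]
  exact ((hp _).comp_const_add _ _).mul_const _

end prodDil

end

section

/-! ### Orthogonality and cancellation -/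

variable {d : ℕ} {γ : ℕ∞} {φ ψ : ℝ → ℝ}

/-- The factors of the tensor product wavelet of type `i`. -/
def factor (φ ψ : ℝ → ℝ) (i : Fin d → Bool) : Fin d → ℝ → ℝ :=
  fun m => if i m then ψ else φ

lemma waveletFun_eq (i : Fin d → Bool) (j : ℕ) (k : Fin d → ℤ) :
    waveletFun φ ψ i j k = prodDil (factor φ ψ i) (2 ^ j) k := by
  ext x
  rw [waveletFun, tensor, prodDil]
  refine Finset.prod_congr rfl fun m _ => ?_
  simp only [factor]
  split_ifs <;> rfl

lemma IsWaveletBasis.regular_factor (hW : IsWaveletBasis d γ φ ψ) (i : Fin d → Bool) (m : Fin d) :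
    RegularFastDecay γ (factor φ ψ i m) := by
  simp only [factor]
  split_ifs
  exacts [hW.regular_wavelet, hW.regular_scaling]

lemma IsWaveletBasis.fastDecay_factor (hW : IsWaveletBasis d γ φ ψ) (i : Fin d → Bool)
    (m : Fin d) : FastDecay (factor φ ψ i m) :=
  (hW.regular_factor i m).fastDecay

lemma IsWaveletBasis.integral_mul (hW : IsWaveletBasis d γ φ ψ)
    (n n' : (Fin d → ℤ) ⊕ (WType d × ℕ × (Fin d → ℤ))) :
    ∫ x, waveletSystem d φ ψ n x * waveletSystem d φ ψ n' x = if n = n' then 1 else 0 := by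
  classical
  obtain ⟨b, hb⟩ := hW.basis
  have h := orthonormal_iff_ite.1 b.orthonormal n n'
  rw [L2.inner_def] at h
  rw [← h]
  refine integral_congr_ae ?_
  filter_upwards [hb n, hb n'] with x h1 h2
  rw [h1, h2]
  simp [mul_comm]

/-- The type `(1, …, 1)`, whose wavelet is the tensor power of `ψ`. -/
def onesType (hd : 0 < d) : WType d :=
  ⟨fun _ => true, fun h => by simpa using congrFun h ⟨0, hd⟩⟩

lemma integral_waveletFun_ones_mul (j j' : ℕ) (k k' : ℤ) :
    ∫ x, waveletFun φ ψ (fun _ : Fin d => true) j (fun _ => k) x *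
      waveletFun φ ψ (fun _ : Fin d => true) j' (fun _ => k') x =
    (∫ t, ψ (2 ^ j * t - k) * ψ (2 ^ j' * t - k')) ^ d := by
  have h := integral_prod_coord fun (_ : Fin d) t => ψ (2 ^ j * t - k) * ψ (2 ^ j' * t - k')
  simp only [Finset.prod_const, Finset.card_univ, Fintype.card_fin] at h
  rw [← h]
  refine integral_congr_ae (Eventually.of_forall fun x => ?_)
  simp only [waveletFun, tensor, if_true]
  rw [Finset.prod_mul_distrib]

lemma IsWaveletBasis.integral_one_dim (hW : IsWaveletBasis d γ φ ψ) (hd : 0 < d) {j : ℕ}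
    (hj : 0 < j) (k : ℤ) : ∫ t, ψ t * ψ (2 ^ j * t - k) = 0 := by
  have h := hW.integral_mul (Sum.inr (onesType hd, 0, fun _ => 0))
    (Sum.inr (onesType hd, j, fun _ => k))
  rw [if_neg (by simp [hj.ne])] at h
  have h1 : ∀ x, waveletSystem d φ ψ (Sum.inr (onesType hd, 0, fun _ => 0)) x *
      waveletSystem d φ ψ (Sum.inr (onesType hd, j, fun _ => k)) x = √((2 : ℝ) ^ (d * j)) *
      (waveletFun φ ψ (fun _ : Fin d => true) 0 (fun _ => 0) x *
      waveletFun φ ψ (fun _ : Fin d => true) j (fun _ => k) x) := by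
    intro x
    simp only [waveletSystem, onesType, mul_zero, pow_zero, Real.sqrt_one, one_mul]
    ring
  simp_rw [h1] at h
  rw [integral_const_mul, integral_waveletFun_ones_mul] at h
  have h2 : √((2 : ℝ) ^ (d * j)) ≠ 0 := by positivity
  simpa using eq_zero_of_pow_eq_zero ((mul_eq_zero.1 h).resolve_left h2)

lemma IsWaveletBasis.exists_ne_zero (hW : IsWaveletBasis d γ φ ψ) (hd : 0 < d) :
    ∃ t, ψ t ≠ 0 := by
  by_contra! h0
  have h := hW.integral_mul (Sum.inr (onesType hd, 0, fun _ => 0))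
    (Sum.inr (onesType hd, 0, fun _ => 0))
  rw [if_pos rfl] at h
  have h1 : ∀ x, waveletSystem d φ ψ (Sum.inr (onesType hd, 0, fun _ => 0)) x = 0 := by
    intro x
    simp [waveletSystem, onesType, waveletFun, tensor, h0, hd.ne']
  simp [h1] at h

/-- The dyadic numbers are dense: a continuous function that vanishes on them is zero. -/
lemma exists_dyadic_ne_zero {g : ℝ → ℝ} (hg : Continuous g) {x : ℝ} (hx : g x ≠ 0) :
    ∃ (J : ℕ) (K : ℤ), g (K / 2 ^ J) ≠ 0 := by
  by_contra! h
  have h1 : Tendsto (fun J : ℕ => ((⌊x * 2 ^ J⌋ : ℤ) : ℝ) / 2 ^ J) atTop (nhds x) := by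
    have h2 : Tendsto (fun J : ℕ => x - ((1 : ℝ) / 2) ^ J) atTop (nhds x) := by
      simpa using (tendsto_const_nhds (x := x)).sub
        (tendsto_pow_atTop_nhds_zero_of_lt_one (by norm_num : (0 : ℝ) ≤ 1 / 2) (by norm_num))
    refine tendsto_of_tendsto_of_tendsto_of_le_of_le h2 tendsto_const_nhds (fun J => ?_)
      fun J => ?_
    · have h4 : x - (1 / 2) ^ J = (x * 2 ^ J - 1) / 2 ^ J := by
        rw [one_div, inv_pow]; field_simp
      show x - (1 / 2) ^ J ≤ _
      rw [h4]
      gcongr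
      exact (Int.sub_one_lt_floor _).le
    · show _ / _ ≤ x
      rw [div_le_iff₀ (by positivity)]
      exact Int.floor_le _
  have h3 := (hg.tendsto x).comp h1
  simp only [Function.comp_def, h] at h3
  exact hx (tendsto_nhds_unique h3 tendsto_const_nhds)

/-- No derivative of a nonzero rapidly decreasing function vanishes identically. -/
lemma RegularFastDecay.exists_iteratedDeriv_ne_zero {g : ℝ → ℝ} (hg : RegularFastDecay γ g)
    (h0 : ∃ t, g t ≠ 0) {n : ℕ} (hn : (n : ℕ∞) ≤ γ) : ∃ t, iteratedDeriv n g t ≠ 0 := by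
  induction n with
  | zero => simpa using h0
  | succ n ih =>
    have hn' : (n : ℕ∞) < γ := lt_of_lt_of_le (by exact_mod_cast n.lt_succ_self) hn
    obtain ⟨t, ht⟩ := ih hn'.le
    by_contra! h
    rw [iteratedDeriv_succ] at h
    have hd : Differentiable ℝ (iteratedDeriv n g) :=
      hg.1.differentiable_iteratedDeriv n (by exact_mod_cast hn')
    exact ht ((hg.fastDecay_iteratedDeriv hn'.le).eq_zero_of_const
      fun x => is_const_of_deriv_eq_zero hd h x t)

/-- Repeated integration by parts against the successive primitives `Θ s` of `Θ 0`. -/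
lemma integral_comp_affine_mul_primitives {g : ℝ → ℝ} (hg : RegularFastDecay γ g)
    {Θ : ℕ → ℝ → ℝ} {M : ℕ} (hM : (M : ℕ∞) ≤ γ) (hΘ : ∀ s ≤ M, FastDecay (Θ s))
    (hΘ' : ∀ s < M, ∀ x, HasDerivAt (Θ (s + 1)) (Θ s x) x) (a ρ : ℝ) {s : ℕ} (hs : s ≤ M) :
    ∫ y, g (a + ρ * y) * Θ 0 y = (-ρ) ^ s * ∫ y, iteratedDeriv s g (a + ρ * y) * Θ s y := by
  induction s with
  | zero => simp
  | succ s ih =>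
    rw [ih (by omega), pow_succ, mul_assoc]
    congr 1
    have hsγ : ((s + 1 : ℕ) : ℕ∞) ≤ γ := le_trans (by exact_mod_cast hs) hM
    have hsγ' : (s : ℕ∞) < γ := lt_of_lt_of_le (by exact_mod_cast s.lt_succ_self) hsγ
    have hdiff : Differentiable ℝ (iteratedDeriv s g) :=
      hg.1.differentiable_iteratedDeriv s (by exact_mod_cast hsγ')
    have hF := hg.fastDecay_iteratedDeriv hsγ
    have hF' := hg.fastDecay_iteratedDeriv hsγ'.le
    have hder : ∀ y, HasDerivAt (fun y => iteratedDeriv s g (a + ρ * y))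
        (ρ * iteratedDeriv (s + 1) g (a + ρ * y)) y := by
      intro y
      have h1 := (hdiff (a + ρ * y)).hasDerivAt
      rw [← iteratedDeriv_succ] at h1
      have h2 : HasDerivAt (fun y => a + ρ * y) ρ y := by
        simpa using ((hasDerivAt_id y).const_mul ρ).const_add a
      rw [mul_comm]
      exact h1.comp y h2
    have hint : ∀ {u v : ℝ → ℝ}, FastDecay u → FastDecay v →
        Integrable fun y => u (a + ρ * y) * v y := by
      intro u v hu hv
      obtain ⟨C, hC⟩ := hu.bounded
      have := hu.cont
      exact hv.integrable.bdd_mul (c := C) (by fun_prop)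
        (Eventually.of_forall fun y => hC _)
    rw [integral_mul_deriv_eq_deriv_mul_of_integrable (fun y _ => hder y)
      (fun y _ => hΘ' s (by omega) y)]
    · rw [neg_mul, ← integral_const_mul]
      congr 2; ext y; ring
    · exact hint hF' (hΘ s (by omega))
    · refine ((hint hF (hΘ (s + 1) hs)).const_mul ρ).congr (Eventually.of_forall fun y => ?_)
      simp only [Pi.mul_apply]; ring
    · exact hint hF' (hΘ (s + 1) hs)

/-- Cancellation of the wavelet: `ψ` is the `M`-th derivative of a rapidly decreasing function
when `M ≤ γ` (equivalently, its moments of order `< M` vanish). The orthogonality of `ψ` to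
`ψ(2^j · - k)`, where `k 2^{-j}` is a fixed dyadic point at which `ψ^{(s)}` does not vanish,
forces the primitive of order `s` to have integral zero in the limit `j → ∞`. -/
lemma IsWaveletBasis.exists_primitives (hW : IsWaveletBasis d γ φ ψ) (hd : 0 < d) {M : ℕ}
    (hM : (M : ℕ∞) ≤ γ) :
    ∃ Θ : ℕ → ℝ → ℝ, Θ 0 = ψ ∧ (∀ s ≤ M, FastDecay (Θ s)) ∧
      ∀ s < M, ∀ x, HasDerivAt (Θ (s + 1)) (Θ s x) x := by
  induction M with
  | zero =>
    exact ⟨fun _ => ψ, rfl, fun _ _ => hW.regular_wavelet.fastDecay,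
      fun s hs => absurd hs (Nat.not_lt_zero s)⟩
  | succ M ih =>
    have hMγ : (M : ℕ∞) ≤ γ := le_trans (by exact_mod_cast M.le_succ) hM
    obtain ⟨Θ, h0, h1, h2⟩ := ih hMγ
    have hF := hW.regular_wavelet.fastDecay_iteratedDeriv hMγ
    obtain ⟨t, ht⟩ := hW.regular_wavelet.exists_iteratedDeriv_ne_zero (hW.exists_ne_zero hd) hMγ
    obtain ⟨J, K, hJK⟩ := exists_dyadic_ne_zero hF.cont ht
    set a : ℝ := K / 2 ^ J with ha
    have hz : ∀ j : ℕ, 0 < j →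
        ∫ y, iteratedDeriv M ψ (a + ((1 : ℝ) / 2) ^ (j + J) * y) * Θ M y = 0 := by
      intro j hj
      have h3 := hW.integral_one_dim hd (show 0 < j + J by omega) (2 ^ j * K)
      have h4 := integral_comp_dil (fun y => ψ (a + ((1 : ℝ) / 2) ^ (j + J) * y) * ψ y)
        (show (0 : ℝ) < 2 ^ (j + J) by positivity) ((2 ^ j * K : ℤ) : ℝ)
      have h5 : ∀ t : ℝ, a + ((1 : ℝ) / 2) ^ (j + J) * (2 ^ (j + J) * t - ((2 ^ j * K : ℤ) : ℝ))
          = t := by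
        intro t
        rw [ha, one_div, inv_pow, pow_add]
        push_cast
        field_simp
        ring
      simp only [h5, h3] at h4
      have h6 := (mul_eq_zero.1 h4.symm).resolve_left (by positivity)
      rw [← h0, integral_comp_affine_mul_primitives (γ := γ) (M := M)
        (h0 ▸ hW.regular_wavelet) hMγ h1 h2 _ _ le_rfl, h0] at h6
      exact (mul_eq_zero.1 h6).resolve_left (pow_ne_zero _ (neg_ne_zero.2 (by positivity)))
    have hlim : Tendsto (fun j : ℕ =>
        ∫ y, iteratedDeriv M ψ (a + ((1 : ℝ) / 2) ^ (j + J) * y) * Θ M y) atTop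
        (nhds (∫ y, iteratedDeriv M ψ a * Θ M y)) := by
      obtain ⟨C, hC⟩ := hF.bounded
      have hc := hF.cont
      have hc' := (h1 M le_rfl).cont
      refine tendsto_integral_of_dominated_convergence (fun y => C * |Θ M y|)
        (fun j => by fun_prop) ((h1 M le_rfl).integrable.abs.const_mul C)
        (fun j => Eventually.of_forall fun y => ?_) (Eventually.of_forall fun y => ?_)
      · rw [norm_mul, Real.norm_eq_abs, Real.norm_eq_abs]
        gcongr
        exact hC _
      · refine Tendsto.mul_const _ ((hc.tendsto a).comp ?_)
        have h7 : Tendsto (fun j : ℕ => ((1 : ℝ) / 2) ^ (j + J)) atTop (nhds 0) :=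
          (tendsto_add_atTop_iff_nat J).2
            (tendsto_pow_atTop_nhds_zero_of_lt_one (by norm_num) (by norm_num))
        simpa using (h7.mul_const y).const_add a
    have hI : ∫ y, Θ M y = 0 := by
      have h8 := tendsto_nhds_unique hlim
        (tendsto_const_nhds.congr' ((eventually_gt_atTop 0).mono fun j hj => (hz j hj).symm))
      rw [integral_const_mul] at h8
      exact (mul_eq_zero.1 h8).resolve_left hJK
    obtain ⟨G, hG, hG'⟩ := (h1 M le_rfl).exists_primitive hI
    refine ⟨Function.update Θ (M + 1) G, by simp [h0], fun s hs => ?_, fun s hs x => ?_⟩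
    · rcases eq_or_ne s (M + 1) with rfl | hne
      · simpa using hG
      · rw [Function.update_of_ne hne]
        exact h1 s (by omega)
    · rw [Function.update_of_ne (by omega : s ≠ M + 1)]
      rcases eq_or_ne s M with rfl | hne
      · simpa using hG' x
      · rw [Function.update_of_ne (by omega)]
        exact h2 s (by omega) x

/-- A tensor product wavelet of type `i` is the derivative of order `M` of tensor products, in the
direction of a coordinate whose factor is `ψ`. -/
lemma IsWaveletBasis.exists_tensor_primitives (hW : IsWaveletBasis d γ φ ψ) (hd : 0 < d) {M : ℕ}
    (hM : (M : ℕ∞) ≤ γ) (i : WType d) : ∃ (m : Fin d) (q : ℕ → Fin d → ℝ → ℝ),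
      q 0 = factor φ ψ i.1 ∧ (∀ s ≤ M, ∀ n, FastDecay (q s n)) ∧
      ∀ s < M, ∀ a : ℝ, 0 < a → ∀ (k : Fin d → ℤ) (x : EuclideanSpace ℝ (Fin d)) (t : ℝ),
        HasDerivAt (fun t : ℝ => prodDil (q (s + 1)) a k (x + t • EuclideanSpace.single m a⁻¹))
          (prodDil (q s) a k (x + t • EuclideanSpace.single m a⁻¹)) t := by
  obtain ⟨Θ, h0, hΘ, hΘ'⟩ := hW.exists_primitives hd hM
  obtain ⟨m, hm⟩ : ∃ m, i.1 m = true := by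
    by_contra! h
    exact i.2 (funext fun m => by simpa using h m)
  refine ⟨m, fun s => Function.update (factor φ ψ i.1) m (Θ s), ?_, fun s hs n => ?_,
    fun s hs a ha k x t => hasDerivAt_prodDil_update (hΘ' s hs) ha k x t⟩
  · simp only [h0]
    rw [Function.update_eq_self_iff]
    simp [factor, hm]
  · rcases eq_or_ne n m with rfl | hne
    · simpa using hΘ s hs
    · simpa [Function.update_of_ne hne] using hW.fastDecay_factor i.1 n

end

section

/-! ### Finite differences and the modulus of smoothness -/

section fwdDiff

variable {V : Type*} [AddCommGroup V]

lemma fwdDiff_iter_eq_sum (f : V → ℝ) (h : V) (M : ℕ) (x : V) :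
    ((fwdDiff h)^[M] f) x =
      ∑ n ∈ Finset.range (M + 1), ((-1) ^ (M - n) * (M.choose n : ℝ)) * f (x + n • h) := by
  rw [fwdDiff_iter_eq_sum_shift]
  refine Finset.sum_congr rfl fun n _ => ?_
  simp

lemma sum_abs_binomial (M : ℕ) :
    ∑ n ∈ Finset.range (M + 1), |(-1 : ℝ) ^ (M - n) * (M.choose n : ℝ)| = 2 ^ M := by
  simp only [abs_mul, abs_pow, abs_neg, abs_one, one_pow, one_mul, Nat.abs_cast]
  exact_mod_cast Nat.sum_range_choose M

lemma abs_fwdDiff_iter_le {f : V → ℝ} {B : ℝ} (hf : ∀ x, |f x| ≤ B) (h : V) (M : ℕ) (x : V) :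
    |((fwdDiff h)^[M] f) x| ≤ 2 ^ M * B := by
  rw [fwdDiff_iter_eq_sum, ← sum_abs_binomial, Finset.sum_mul]
  refine (Finset.abs_sum_le_sum_abs _ _).trans (Finset.sum_le_sum fun n _ => ?_)
  rw [abs_mul]
  gcongr
  exact hf _

lemma abs_fwdDiff_nsmul_iter_le (n M : ℕ) {f : V → ℝ} {h : V} {K : ℝ}
    (hf : ∀ x, |((fwdDiff h)^[M] f) x| ≤ K) (x : V) :
    |((fwdDiff (n • h))^[M] f) x| ≤ n ^ M * K := by
  induction M generalizing f x with
  | zero => simpa using hf x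
  | succ M ih =>
    have h1 : fwdDiff (n • h) f
        = ∑ i ∈ Finset.range n, fun x => fwdDiff h f (x + i • h) := by
      ext y
      have h2 := Finset.sum_range_sub (fun i => f (y + i • h)) n
      simp only [zero_smul, add_zero] at h2
      simp only [fwdDiff, Finset.sum_apply]
      rw [← h2]
      refine Finset.sum_congr rfl fun i _ => ?_
      rw [add_smul, one_smul, add_assoc]
    rw [Function.iterate_succ_apply, h1, fwdDiff_iter_finsetSum, Finset.sum_apply]
    refine (Finset.abs_sum_le_sum_abs _ _).trans ?_
    calc _ ≤ ∑ _i ∈ Finset.range n, (n : ℝ) ^ M * K := Finset.sum_le_sum fun i _ => by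
          rw [fwdDiff_iter_comp_add]
          exact ih (fun x => by simpa [Function.iterate_succ_apply] using hf x) _
      _ = _ := by rw [Finset.sum_const, Finset.card_range, nsmul_eq_mul, pow_succ]; ring

end fwdDiff

lemma continuous_fwdDiff_iter {V : Type*} [TopologicalSpace V] [AddCommGroup V]
    [IsTopologicalAddGroup V] {f : V → ℝ} (hf : Continuous f) (h : V) (M : ℕ) :
    Continuous ((fwdDiff h)^[M] f) := by
  have : (fwdDiff h)^[M] f = fun x => _ := funext fun x => fwdDiff_iter_eq_sum f h M x
  rw [this]
  fun_prop

variable {d : ℕ} {f : EuclideanSpace ℝ (Fin d) → ℝ}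

lemma enorm_fwdDiff_le_modulus (M : ℕ) (f : EuclideanSpace ℝ (Fin d) → ℝ) {r : ℝ}
    {h : EuclideanSpace ℝ (Fin d)} (hh : ‖h‖ ≤ r) (x : EuclideanSpace ℝ (Fin d)) :
    ‖((fwdDiff h)^[M] f) x‖ₑ ≤ modulus M f r :=
  le_iSup₂_of_le h hh (le_iSup (fun x => ‖((fwdDiff h)^[M] f) x‖ₑ) x)

lemma modulus_le {M : ℕ} {r : ℝ} {C : ℝ≥0∞} (h : ∀ h : EuclideanSpace ℝ (Fin d), ‖h‖ ≤ r →
    ∀ x, ‖((fwdDiff h)^[M] f) x‖ₑ ≤ C) : modulus M f r ≤ C :=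
  iSup₂_le fun u hu => iSup_le fun x => h u hu x

lemma modulus_mono (M : ℕ) (f : EuclideanSpace ℝ (Fin d) → ℝ) : Monotone (modulus M f) :=
  fun _ _ hr => modulus_le fun _ hu x => enorm_fwdDiff_le_modulus M f (hu.trans hr) x

lemma enorm_le_ofReal {a b : ℝ} (h : |a| ≤ b) : ‖a‖ₑ ≤ ENNReal.ofReal b := by
  rw [Real.enorm_eq_ofReal_abs]
  exact ENNReal.ofReal_le_ofReal h

lemma abs_le_toReal_of_enorm_le {a : ℝ} {b : ℝ≥0∞} (hb : b ≠ ⊤) (h : ‖a‖ₑ ≤ b) :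
    |a| ≤ b.toReal := by
  rw [← Real.norm_eq_abs, ← toReal_enorm]
  exact ENNReal.toReal_mono hb h

lemma modulus_ne_top (hf : IsBoundedFun f) (M : ℕ) (r : ℝ) : modulus M f r ≠ ⊤ := by
  obtain ⟨B, hB⟩ := hf
  exact ((modulus_le fun h _ x => enorm_le_ofReal (abs_fwdDiff_iter_le hB h M x)).trans_lt
    ENNReal.ofReal_lt_top).ne

lemma modulus_add_le (hf : IsBoundedFun f) (M s : ℕ) (r : ℝ) :
    modulus (M + s) f r ≤ 2 ^ s * modulus M f r := by
  have ht := modulus_ne_top hf M r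
  refine modulus_le fun h hh x => ?_
  have h1 := abs_fwdDiff_iter_le (fun x => abs_le_toReal_of_enorm_le ht
    (enorm_fwdDiff_le_modulus M f hh x)) h s x
  rw [← Function.iterate_add_apply, add_comm s M] at h1
  refine (enorm_le_ofReal h1).trans (le_of_eq ?_)
  rw [ENNReal.ofReal_mul (by positivity), ENNReal.ofReal_toReal ht,
    ENNReal.ofReal_pow (by norm_num), ENNReal.ofReal_ofNat]

lemma modulus_nat_mul_le (hf : IsBoundedFun f) (M : ℕ) {n : ℕ} (hn : 0 < n) (r : ℝ) :
    modulus M f (n * r) ≤ n ^ M * modulus M f r := by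
  have ht := modulus_ne_top hf M r
  have hn' : (0 : ℝ) < n := by exact_mod_cast hn
  refine modulus_le fun h hh x => ?_
  have hh' : ‖(n : ℝ)⁻¹ • h‖ ≤ r := by
    rw [norm_smul, norm_inv, Real.norm_natCast, inv_mul_le_iff₀ hn']
    exact hh
  have h1 := abs_fwdDiff_nsmul_iter_le n M (fun x => abs_le_toReal_of_enorm_le ht
    (enorm_fwdDiff_le_modulus M f hh' x)) x
  have h2 : n • (n : ℝ)⁻¹ • h = h := by
    rw [← Nat.cast_smul_eq_nsmul ℝ, smul_smul, mul_inv_cancel₀ hn'.ne', one_smul]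
  rw [h2] at h1
  refine (enorm_le_ofReal h1).trans (le_of_eq ?_)
  rw [ENNReal.ofReal_mul (by positivity), ENNReal.ofReal_toReal ht,
    ENNReal.ofReal_pow (by positivity), ENNReal.ofReal_natCast]

/-! ### Steklov averages -/

section avg

variable {V : Type*} [NormedAddCommGroup V] [NormedSpace ℝ V]

/-- The average of `g` over the segment `[x, x + w]`. -/
def avg (w : V) (g : V → ℝ) (x : V) : ℝ := ∫ t in (0 : ℝ)..1, g (x + t • w)

lemma continuous_avg {w : V} {g : V → ℝ} (hg : Continuous g) : Continuous (avg w g) :=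
  intervalIntegral.continuous_parametric_intervalIntegral_of_continuous' (by fun_prop) _ _

lemma abs_avg_le {w : V} {g : V → ℝ} {B : ℝ} {x : V}
    (hB : ∀ t ∈ Set.Icc (0 : ℝ) 1, |g (x + t • w)| ≤ B) : |avg w g x| ≤ B := by
  have h := intervalIntegral.norm_integral_le_of_norm_le_const (a := 0) (b := 1) (C := B)
    (f := fun t : ℝ => g (x + t • w)) fun t ht => by
      rw [Set.uIoc_of_le zero_le_one] at ht
      exact hB t ⟨ht.1.le, ht.2⟩
  simpa [avg] using h

lemma continuous_avg_iter {w : V} {g : V → ℝ} (hg : Continuous g) (s : ℕ) :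
    Continuous ((avg w)^[s] g) := by
  induction s with
  | zero => exact hg
  | succ s ih => rw [Function.iterate_succ_apply']; exact continuous_avg ih

lemma abs_avg_iter_le {w : V} {g : V → ℝ} {B : ℝ} (hB : ∀ x, |g x| ≤ B) (s : ℕ) (x : V) :
    |((avg w)^[s] g) x| ≤ B := by
  induction s generalizing x with
  | zero => exact hB x
  | succ s ih => rw [Function.iterate_succ_apply']; exact abs_avg_le fun t _ => ih _

lemma avg_fwdDiff {w u : V} {g : V → ℝ} (hg : Continuous g) :
    avg w (fwdDiff u g) = fwdDiff u (avg w g) := by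
  ext x
  simp only [avg, fwdDiff]
  rw [intervalIntegral.integral_sub
    (Continuous.intervalIntegrable (by fun_prop) _ _)
    (Continuous.intervalIntegrable (by fun_prop) _ _)]
  simp_rw [add_right_comm x _ u]

lemma avg_iter_fwdDiff {w u : V} {g : V → ℝ} (hg : Continuous g) (s : ℕ) :
    (avg w)^[s] (fwdDiff u g) = fwdDiff u ((avg w)^[s] g) := by
  induction s with
  | zero => rfl
  | succ s ih =>
    rw [Function.iterate_succ_apply', ih, avg_fwdDiff (continuous_avg_iter hg s),
      Function.iterate_succ_apply']

lemma avg_zero_iter (g : V → ℝ) (s : ℕ) : (avg (0 : V))^[s] g = g := by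
  induction s with
  | zero => rfl
  | succ s ih =>
    rw [Function.iterate_succ_apply', ih]
    ext x
    simp [avg]

lemma avg_iter_sum {ι : Type*} (S : Finset ι) (w : V) (c : ι → ℝ) {G : ι → V → ℝ}
    (hG : ∀ i, Continuous (G i)) (s : ℕ) (x : V) :
    ((avg w)^[s] fun x => ∑ i ∈ S, c i * G i x) x = ∑ i ∈ S, c i * ((avg w)^[s] (G i)) x := by
  induction s generalizing x with
  | zero => rfl
  | succ s ih =>
    simp only [Function.iterate_succ_apply']
    have h1 := fun i => continuous_avg_iter (w := w) (hG i) s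
    simp only [avg, ih]
    rw [intervalIntegral.integral_finsetSum]
    · simp_rw [intervalIntegral.integral_const_mul]
    · intro i _
      exact Continuous.intervalIntegrable (by have := h1 i; fun_prop) _ _

/-- Averaging along `w` only sees the restriction of the function to the lines of direction `w`. -/
lemma avg_iter_line (w : V) (g : V → ℝ) (x : V) (s : ℕ) (σ : ℝ) :
    ((avg w)^[s] g) (x + σ • w) = ((avg (1 : ℝ))^[s] fun τ => g (x + τ • w)) σ := by
  induction s generalizing σ with
  | zero => rfl
  | succ s ih =>
    simp only [Function.iterate_succ_apply']
    simp only [avg, smul_eq_mul, mul_one, ← ih, add_smul, add_assoc]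

lemma abs_avg_one_iter_le {G : ℝ → ℝ} {M s : ℕ} {K : ℝ}
    (hG : ∀ τ ∈ Set.Icc (0 : ℝ) M, |G τ| ≤ K) {σ : ℝ} (h0 : 0 ≤ σ) (h1 : σ + s ≤ M) :
    |((avg (1 : ℝ))^[s] G) σ| ≤ K := by
  induction s generalizing σ with
  | zero => exact hG σ ⟨h0, by simpa using h1⟩
  | succ s ih =>
    rw [Function.iterate_succ_apply']
    push_cast at h1
    refine abs_avg_le fun t ht => ih ?_ ?_
    · simp only [smul_eq_mul, mul_one]; linarith [ht.1]
    · simp only [smul_eq_mul, mul_one]; linarith [ht.2]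

/-- The binomial combination of the iterated averages in the directions `n • v`, whose term of
index `0` is `± g`, is an average of the differences `Δ_{τv}^M g` with `0 ≤ τ ≤ M`. -/
lemma abs_sum_avg_iter_le {v : V} {g : V → ℝ} (hg : Continuous g) {M : ℕ} {K : ℝ}
    (hK : ∀ τ ∈ Set.Icc (0 : ℝ) M, ∀ x, |((fwdDiff (τ • v))^[M] g) x| ≤ K) (x : V) :
    |∑ n ∈ Finset.range (M + 1),
      ((-1) ^ (M - n) * (M.choose n : ℝ)) * ((avg (n • v))^[M] g) x| ≤ K := by
  have h1 : ∀ n : ℕ, ((avg (n • v))^[M] g) x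
      = ((avg (1 : ℝ))^[M] fun τ => g (x + τ • (n • v))) 0 := by
    intro n
    rw [← avg_iter_line]
    simp
  simp_rw [h1]
  rw [← avg_iter_sum _ _ _ (G := fun (n : ℕ) τ => g (x + τ • (n • v)))
    (fun n => by fun_prop) M 0]
  refine abs_avg_one_iter_le (M := M) (fun τ hτ => ?_) le_rfl (by simp)
  have h2 := hK τ hτ x
  rw [fwdDiff_iter_eq_sum] at h2
  simpa only [smul_comm τ] using h2

variable [FiniteDimensional ℝ V] [MeasurableSpace V] [BorelSpace V] {μ : Measure V}
  [μ.IsAddHaarMeasure]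

/-- Averaging is dual to differentiation: a derivative on the other factor turns the average
into a finite difference. -/
lemma integral_avg_mul {w : V} {g θ Θ : V → ℝ} {c B : ℝ} (hg : Continuous g)
    (hB : ∀ x, |g x| ≤ B) (hθ : Continuous θ) (hθi : Integrable θ μ) (hΘi : Integrable Θ μ)
    (hder : ∀ (x : V) (t : ℝ), HasDerivAt (fun t : ℝ => Θ (x + t • w)) (c * θ (x + t • w)) t) :
    c * ∫ x, avg w g x * θ x ∂μ = -∫ x, fwdDiff w g x * Θ x ∂μ := by
  have hbd : ∀ {u F : V → ℝ}, Continuous u → (∀ x, |u x| ≤ B) → Integrable F μ →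
      Integrable (fun x => u x * F x) μ := fun hu hb hF =>
    hF.bdd_mul (c := B) hu.aestronglyMeasurable (Eventually.of_forall hb)
  set ν : Measure ℝ := volume.restrict (Set.Ioc 0 1) with hν
  have hI1 : Integrable (fun p : V × ℝ => g (p.1 + p.2 • w) * θ p.1) (μ.prod ν) :=
    (hθi.comp_fst ν).bdd_mul (c := B) (by fun_prop) (Eventually.of_forall fun p => hB _)
  have hI2 : Integrable (fun p : V × ℝ => g p.1 * θ (p.1 - p.2 • w)) (μ.prod ν) := by
    rw [integrable_prod_iff' (by fun_prop)]
    refine ⟨Eventually.of_forall fun t => hbd hg hB (hθi.comp_sub_right (t • w)), ?_⟩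
    refine hI1.integral_norm_prod_right.congr (Eventually.of_forall fun t => ?_)
    show ∫ x, ‖g (x + t • w) * θ x‖ ∂μ = ∫ x, ‖g x * θ (x - t • w)‖ ∂μ
    rw [← integral_add_right_eq_self (fun x => ‖g x * θ (x - t • w)‖) (t • w)]
    simp
  calc c * ∫ x, avg w g x * θ x ∂μ
      = c * ∫ x, ∫ t, g (x + t • w) * θ x ∂ν ∂μ := by
        simp_rw [avg, intervalIntegral.integral_of_le zero_le_one, integral_mul_const]
        rfl
    _ = c * ∫ t, ∫ x, g (x + t • w) * θ x ∂μ ∂ν := by rw [integral_integral_swap hI1]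
    _ = c * ∫ t, ∫ x, g x * θ (x - t • w) ∂μ ∂ν := by
        congr 2; ext t
        rw [← integral_add_right_eq_self (fun x => g x * θ (x - t • w)) (t • w)]
        simp
    _ = c * ∫ x, ∫ t, g x * θ (x - t • w) ∂ν ∂μ := by
        rw [integral_integral_swap (f := fun x t => g x * θ (x - t • w)) hI2]
    _ = ∫ x, (g x * Θ x - g x * Θ (x - w)) ∂μ := by
        rw [← integral_const_mul]
        congr 1; ext x
        rw [integral_const_mul, hν, ← intervalIntegral.integral_of_le zero_le_one]
        have h3 : ∀ t ∈ Set.uIcc (0 : ℝ) 1, HasDerivAt (fun t : ℝ => -Θ (x - t • w))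
            (c * θ (x - t • w)) t := by
          intro t _
          have h4 := (hder x (-t)).scomp t (hasDerivAt_neg t)
          simpa [Function.comp_def, sub_eq_add_neg] using h4.fun_neg
        have h5 := intervalIntegral.integral_eq_sub_of_hasDerivAt h3
          (Continuous.intervalIntegrable (by fun_prop) _ _)
        rw [intervalIntegral.integral_const_mul] at h5
        rw [mul_left_comm, h5]
        simp
        ring
    _ = (∫ x, g x * Θ x ∂μ) - ∫ x, g x * Θ (x - w) ∂μ :=
        integral_sub (hbd hg hB hΘi) (hbd hg hB (hΘi.comp_sub_right w))
    _ = (∫ x, g x * Θ x ∂μ) - ∫ x, g (x + w) * Θ x ∂μ := by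
        congr 1
        rw [← integral_add_right_eq_self (fun x => g x * Θ (x - w)) w]
        simp
    _ = -∫ x, fwdDiff w g x * Θ x ∂μ := by
        rw [← integral_sub (hbd hg hB hΘi)
          (hbd (u := fun x => g (x + w)) (by fun_prop) (fun x => hB _) hΘi), ← integral_neg]
        congr 1; ext x
        simp only [fwdDiff]; ring

lemma integral_avg_iter_mul {w : V} {θ : ℕ → V → ℝ} {c : ℝ} (hc : c ≠ 0) {M : ℕ}
    (hθ : ∀ s ≤ M, Continuous (θ s)) (hθi : ∀ s ≤ M, Integrable (θ s) μ)
    (hder : ∀ s < M, ∀ (x : V) (t : ℝ),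
      HasDerivAt (fun t : ℝ => θ (s + 1) (x + t • w)) (c * θ s (x + t • w)) t)
    {s i : ℕ} (hs : i + s ≤ M) {g : V → ℝ} {B : ℝ} (hg : Continuous g) (hB : ∀ x, |g x| ≤ B) :
    ∫ x, ((avg w)^[s] g) x * θ i x ∂μ
      = (-c⁻¹) ^ s * ∫ x, ((fwdDiff w)^[s] g) x * θ (i + s) x ∂μ := by
  induction s generalizing i g B with
  | zero => simp
  | succ s ih =>
    have h1 := integral_avg_mul (μ := μ) (w := w) (continuous_avg_iter (w := w) hg s)
      (abs_avg_iter_le hB s) (hθ i (by omega)) (hθi i (by omega)) (hθi (i + 1) (by omega))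
      (hder i (by omega))
    rw [← avg_iter_fwdDiff hg, ih (i := i + 1) (g := fwdDiff w g) (by omega)
      (continuous_fwdDiff_iter hg w 1) (abs_fwdDiff_iter_le hB w 1)] at h1
    rw [Function.iterate_succ_apply', Function.iterate_succ_apply, ← add_assoc,
      add_right_comm i s 1, (eq_inv_mul_iff_mul_eq₀ hc).2 h1, pow_succ]
    ring

/-- A function `θ 0` with `M` successive primitives in the direction `v` integrates `g` to an
amount controlled by the differences of order `M` of `g` along `v`. -/
lemma abs_integral_mul_le_of_primitives {v : V} {θ : ℕ → V → ℝ} {M : ℕ}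
    (hθ : ∀ s ≤ M, Continuous (θ s)) (hθi : ∀ s ≤ M, Integrable (θ s) μ)
    (hder : ∀ s < M, ∀ (x : V) (t : ℝ),
      HasDerivAt (fun t : ℝ => θ (s + 1) (x + t • v)) (θ s (x + t • v)) t)
    {g : V → ℝ} {B : ℝ} (hg : Continuous g) (hB : ∀ x, |g x| ≤ B) {K : ℝ}
    (hK : ∀ τ ∈ Set.Icc (0 : ℝ) M, ∀ x, |((fwdDiff (τ • v))^[M] g) x| ≤ K) :
    |∫ x, g x * θ 0 x ∂μ| ≤ K * ((∫ x, |θ 0 x| ∂μ) + 2 ^ M * ∫ x, |θ M x| ∂μ) := by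
  have hbound : ∀ {u F : V → ℝ}, (∀ x, |u x| ≤ K) → Integrable F μ →
      |∫ x, u x * F x ∂μ| ≤ K * ∫ x, |F x| ∂μ := by
    intro u F hu hF
    rw [← integral_const_mul, ← Real.norm_eq_abs]
    refine norm_integral_le_of_norm_le (hF.abs.const_mul K) (Eventually.of_forall fun x => ?_)
    rw [norm_mul]
    exact mul_le_mul_of_nonneg_right (hu x) (abs_nonneg _)
  have hK0 : 0 ≤ K := (abs_nonneg _).trans (hK 0 ⟨le_rfl, by positivity⟩ 0)
  set c : ℕ → ℝ := fun n => (-1) ^ (M - n) * (M.choose n : ℝ) with hc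
  have hi : ∀ n : ℕ, Integrable (fun x => c n * (((avg (n • v))^[M] g) x * θ 0 x)) μ := fun n =>
    ((hθi 0 (Nat.zero_le _)).bdd_mul (c := B) (continuous_avg_iter hg M).aestronglyMeasurable
      (Eventually.of_forall (abs_avg_iter_le hB M))).const_mul _
  have h1 : ∫ x, (∑ n ∈ Finset.range (M + 1), c n * ((avg (n • v))^[M] g) x) * θ 0 x ∂μ
      = ∑ n ∈ Finset.range (M + 1), c n * ∫ x, ((avg (n • v))^[M] g) x * θ 0 x ∂μ := by
    simp_rw [Finset.sum_mul, mul_assoc]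
    rw [integral_finsetSum _ fun n _ => hi n]
    simp_rw [integral_const_mul]
  have h2 := hbound (abs_sum_avg_iter_le hg hK) (hθi 0 (Nat.zero_le _))
  -- the term of index `0` is `±∫ g θ₀`; in the others the averages become differences
  rw [h1, Finset.sum_range_succ'] at h2
  simp only [zero_smul, avg_zero_iter] at h2
  have h3 : ∀ n ∈ Finset.range M,
      |c (n + 1) * ∫ x, ((avg ((n + 1) • v))^[M] g) x * θ 0 x ∂μ|
        ≤ |c (n + 1)| * (K * ∫ x, |θ M x| ∂μ) := by
    intro n hn
    have hn1 : ((n + 1 : ℕ) : ℝ) ≠ 0 := by positivity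
    rw [integral_avg_iter_mul (μ := μ) (c := ((n + 1 : ℕ) : ℝ)) hn1 hθ hθi (fun s hs x t => ?_)
      (s := M) (i := 0) (by simp) hg hB, abs_mul, zero_add]
    · refine mul_le_mul_of_nonneg_left ?_ (abs_nonneg _)
      rw [abs_mul]
      have h4 : |(-((n + 1 : ℕ) : ℝ)⁻¹) ^ M| ≤ 1 := by
        rw [abs_pow, abs_neg, abs_inv, Nat.abs_cast]
        refine pow_le_one₀ (by positivity) (inv_le_one_of_one_le₀ ?_)
        push_cast; linarith [(n.cast_nonneg : (0 : ℝ) ≤ n)]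
      have h5 := hbound (u := (fwdDiff ((n + 1) • v))^[M] g) (F := θ M) (fun x => by
        have h6 := hK ((n + 1 : ℕ) : ℝ) ⟨by positivity, by
          exact_mod_cast Nat.succ_le_of_lt (Finset.mem_range.1 hn)⟩ x
        rwa [Nat.cast_smul_eq_nsmul] at h6) (hθi M le_rfl)
      calc _ ≤ 1 * (K * ∫ x, |θ M x| ∂μ) := mul_le_mul h4 h5 (abs_nonneg _) zero_le_one
        _ = _ := one_mul _
    · have h6 := (hder s hs x (((n + 1 : ℕ) : ℝ) * t)).comp t
        ((hasDerivAt_id t).const_mul ((n + 1 : ℕ) : ℝ))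
      have h7 : ∀ t : ℝ, (((n + 1 : ℕ) : ℝ) * t) • v = t • ((n + 1) • v) := fun t => by
        rw [mul_comm, mul_smul, Nat.cast_smul_eq_nsmul]
      simp only [Function.comp_def, h7, mul_one] at h6
      rw [mul_comm]
      exact h6
  have h8 : |c 0 * ∫ x, g x * θ 0 x ∂μ| = |∫ x, g x * θ 0 x ∂μ| := by
    simp [hc, abs_mul, abs_pow]
  rw [← h8]
  have h9 : ∑ n ∈ Finset.range M, |c (n + 1)| ≤ 2 ^ M := by
    rw [← sum_abs_binomial, Finset.sum_range_succ']
    exact le_add_of_nonneg_right (abs_nonneg _)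
  set S := ∑ n ∈ Finset.range M, c (n + 1) * ∫ x, ((avg ((n + 1) • v))^[M] g) x * θ 0 x ∂μ
  set T := c 0 * ∫ x, g x * θ 0 x ∂μ
  have hS : |S| ≤ 2 ^ M * (K * ∫ x, |θ M x| ∂μ) := by
    refine (Finset.abs_sum_le_sum_abs _ _).trans ((Finset.sum_le_sum h3).trans ?_)
    rw [← Finset.sum_mul]
    exact mul_le_mul_of_nonneg_right h9
      (mul_nonneg hK0 (integral_nonneg fun x => abs_nonneg _))
  calc |T| = |(S + T) - S| := by rw [add_sub_cancel_left]
    _ ≤ |S + T| + |S| := abs_sub _ _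
    _ ≤ _ := add_le_add h2 hS
    _ = _ := by ring

end avg

/-! ### Wavelet coefficients are controlled by the modulus of smoothness -/

variable {γ : ℕ∞} {φ ψ : ℝ → ℝ}

/-- Uniformly in `j`, the coefficients at scale `j` are at most a constant times the modulus of
smoothness of order `M ≤ γ` at `2⁻ʲ`. -/
lemma IsWaveletBasis.exists_coeffSup_le (hW : IsWaveletBasis d γ φ ψ) (hd : 0 < d) {M : ℕ}
    (hM0 : 0 < M) (hM : (M : ℕ∞) ≤ γ) : ∃ C : ℝ≥0∞, C ≠ ⊤ ∧
      ∀ f : EuclideanSpace ℝ (Fin d) → ℝ, IsBoundedFun f → Continuous f → ∀ j : ℕ,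
        coeffSup φ ψ f j ≤ C * modulus M f ((2 ^ j)⁻¹) := by
  have hex : ∀ i : WType d, ∃ C : ℝ≥0∞, C ≠ ⊤ ∧
      ∀ f : EuclideanSpace ℝ (Fin d) → ℝ, IsBoundedFun f → Continuous f → ∀ j k,
        ‖coeff φ ψ f i j k‖ₑ ≤ C * modulus M f ((2 ^ j)⁻¹) := by
    intro i
    obtain ⟨m, q, hq0, hqd, hq'⟩ := hW.exists_tensor_primitives hd hM i
    set N : ℕ → ℝ := fun s => ∏ n, ∫ t, |q s n t| with hN
    refine ⟨ENNReal.ofReal (N 0 + 2 ^ M * N M) * M ^ M,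
      ENNReal.mul_ne_top ENNReal.ofReal_ne_top (by finiteness), fun f hf hfc j k => ?_⟩
    have hj : (0 : ℝ) < 2 ^ j := by positivity
    have ht := modulus_ne_top hf M (M * (2 ^ j)⁻¹)
    obtain ⟨B, hB⟩ := hf
    have h1 := abs_integral_mul_le_of_primitives (μ := volume)
      (v := EuclideanSpace.single m ((2 : ℝ) ^ j)⁻¹) (θ := fun s => prodDil (q s) (2 ^ j) k)
      (fun s hs => continuous_prodDil (hqd s hs) _ _)
      (fun s hs => integrable_prodDil (hqd s hs) hj _)
      (fun s hs x t => hq' s hs _ hj k x t) hfc hB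
      (K := (modulus M f (M * (2 ^ j)⁻¹)).toReal) (fun τ hτ x => by
        refine abs_le_toReal_of_enorm_le ht (enorm_fwdDiff_le_modulus M f ?_ x)
        rw [norm_smul, PiLp.norm_single, Real.norm_of_nonneg hτ.1,
          Real.norm_of_nonneg (by positivity)]
        exact mul_le_mul_of_nonneg_right hτ.2 (by positivity))
    simp only [integral_abs_prodDil hj, hq0] at h1
    have h2 : |coeff φ ψ f i j k| ≤
        (N 0 + 2 ^ M * N M) * (modulus M f (M * (2 ^ j)⁻¹)).toReal := by
      rw [coeff, abs_mul, abs_of_pos (by positivity : (0 : ℝ) < 2 ^ (d * j)), waveletFun_eq]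
      refine (mul_le_mul_of_nonneg_left h1 (by positivity)).trans (le_of_eq ?_)
      rw [← pow_mul, mul_comm j d, hN]
      simp only [hq0]
      field_simp
    refine (enorm_le_ofReal h2).trans ?_
    rw [ENNReal.ofReal_mul' ENNReal.toReal_nonneg, ENNReal.ofReal_toReal ht, mul_assoc]
    gcongr
    exact modulus_nat_mul_le ⟨B, hB⟩ M hM0 _
  choose C hC h using hex
  refine ⟨∑ i, C i, ENNReal.sum_ne_top.2 fun i _ => hC i, fun f hf hfc j => ?_⟩
  refine iSup₂_le fun i k => (h i f hf hfc j k).trans ?_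
  gcongr
  exact Finset.single_le_sum (f := C) (fun _ _ => zero_le) (Finset.mem_univ i)

end

section

/-! ### Differences of the wavelets -/

/-- A difference of order `M` with step `1` is bounded by the derivative of order `M`. -/
lemma abs_fwdDiff_one_iter_le {M : ℕ} {G : ℝ → ℝ} (hG : ContDiff ℝ M G) {x K : ℝ}
    (hK : ∀ t ∈ Set.Icc x (x + M), |iteratedDeriv M G t| ≤ K) :
    |((fwdDiff (1 : ℝ))^[M] G) x| ≤ K := by
  induction M generalizing G with
  | zero => simpa using hK x (by simp)
  | succ M ih =>
    rw [Function.iterate_succ_apply]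
    have hG' : ContDiff ℝ M G := hG.of_le (by exact_mod_cast M.le_succ)
    have hsh : ContDiff ℝ M fun y => G (y + 1) := hG'.comp (by fun_prop)
    refine ih (G := fwdDiff (1 : ℝ) G) (hsh.sub hG') fun t ht => ?_
    have h1 : iteratedDeriv M (fwdDiff (1 : ℝ) G) t
        = iteratedDeriv M G (t + 1) - iteratedDeriv M G t := by
      have h2 : fwdDiff (1 : ℝ) G = fun y => G (y + 1) - G y := rfl
      rw [h2, iteratedDeriv_fun_sub hsh.contDiffAt hG'.contDiffAt, iteratedDeriv_comp_add_const]
    have hd : Differentiable ℝ (iteratedDeriv M G) :=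
      hG.differentiable_iteratedDeriv M (by exact_mod_cast M.lt_succ_self)
    have h3 := Convex.norm_image_sub_le_of_norm_deriv_le (f := iteratedDeriv M G) (C := K)
      (s := Set.Icc x (x + (M + 1 : ℕ))) (fun y _ => hd y)
      (fun y hy => by rw [← iteratedDeriv_succ]; exact hK y hy) (convex_Icc _ _)
      (x := t) (y := t + 1)
      ⟨ht.1, by push_cast; linarith [ht.2]⟩ ⟨by linarith [ht.1], by push_cast; linarith [ht.2]⟩
    rw [h1]
    simpa using h3

section prodDil

variable {d : ℕ} {γ : ℕ∞} {q : Fin d → ℝ → ℝ}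

/-- Differences of order `M` of a tensor product, for steps at most the scale `a⁻¹`. -/
lemma exists_abs_fwdDiff_prodDil_le (hq : ∀ m, RegularFastDecay γ (q m)) {M : ℕ}
    (hM : (M : ℕ∞) ≤ γ) : ∃ C : ℝ, 0 ≤ C ∧ ∀ (a : ℝ) (k : Fin d → ℤ)
      (x h : EuclideanSpace ℝ (Fin d)), 0 ≤ a → a * ‖h‖ ≤ 1 →
      |((fwdDiff h)^[M] (prodDil q a k)) x| ≤
        C * (a * ‖h‖) ^ M * ∏ m, ((1 + |a * x m - k m|) ^ 2)⁻¹ := by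
  have hex : ∀ m, ∃ D : ℝ, 0 ≤ D ∧ ∀ p ≤ M, ∀ z, |iteratedDeriv p (q m) z| * (1 + |z|) ^ 2 ≤ D := by
    intro m
    have h1 : ∀ p : ℕ, ∃ D : ℝ, p ≤ M → ∀ z, |iteratedDeriv p (q m) z| * (1 + |z|) ^ 2 ≤ D := by
      intro p
      by_cases hp : p ≤ M
      · obtain ⟨D, hD⟩ := (hq m).2 p (le_trans (by exact_mod_cast hp) hM) 2
        exact ⟨D, fun _ => hD⟩
      · exact ⟨0, fun h => absurd h hp⟩
    choose D hD using h1
    refine ⟨∑ p ∈ Finset.range (M + 1), |D p|, Finset.sum_nonneg fun _ _ => abs_nonneg _,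
      fun p hp z => (hD p hp z).trans ((le_abs_self _).trans ?_)⟩
    exact Finset.single_le_sum (f := fun p => |D p|) (fun _ _ => abs_nonneg _)
      (Finset.mem_range.2 (by omega))
  choose D hD0 hD using hex
  refine ⟨∑ p ∈ (Finset.univ : Finset (Fin d)).sym M, ((p : Multiset (Fin d)).countPerms : ℝ) *
    ∏ m, (D m * (1 + M) ^ 2), Finset.sum_nonneg fun p _ => mul_nonneg (Nat.cast_nonneg _)
      (Finset.prod_nonneg fun m _ => mul_nonneg (hD0 m) (by positivity)), ?_⟩
  intro a k x h ha hah
  set ρ := a * ‖h‖ with hρ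
  have hρ0 : 0 ≤ ρ := by positivity
  set y : Fin d → ℝ := fun m => a * x m - k m with hy
  set u : Fin d → ℝ := fun m => a * h m with hu
  have hu' : ∀ m, |u m| ≤ ρ := by
    intro m
    rw [hu, hρ]
    simp only [abs_mul, abs_of_nonneg ha]
    exact mul_le_mul_of_nonneg_left (PiLp.norm_apply_le h m) ha
  set F : Fin d → ℝ → ℝ := fun m t => q m (y m + u m * t) with hF
  have hFc : ∀ m, ContDiff ℝ M (F m) := by
    intro m
    have h1 : ContDiff ℝ M (q m) := (hq m).1.of_le (by exact_mod_cast hM)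
    exact h1.comp (by fun_prop)
  -- reduction to one variable, along the line through `x` of direction `h`
  have hred : ((fwdDiff h)^[M] (prodDil q a k)) x
      = ((fwdDiff (1 : ℝ))^[M] fun t => ∏ m, F m t) 0 := by
    rw [fwdDiff_iter_eq_sum, fwdDiff_iter_eq_sum]
    refine Finset.sum_congr rfl fun n _ => ?_
    congr 1
    refine Finset.prod_congr rfl fun m _ => ?_
    simp only [hF, hy, hu, PiLp.add_apply, PiLp.smul_apply, nsmul_eq_mul, mul_one, zero_add]
    congr 1
    ring
  rw [hred]
  refine abs_fwdDiff_one_iter_le (contDiff_prod fun m _ => hFc m) fun t ht => ?_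
  rw [zero_add] at ht
  rw [← Real.norm_eq_abs, ← norm_iteratedFDeriv_eq_norm_iteratedDeriv]
  refine (norm_iteratedFDeriv_prod_le (N := M) (fun m _ => hFc m) le_rfl).trans ?_
  rw [Finset.sum_mul, Finset.sum_mul]
  refine Finset.sum_le_sum fun p hp => ?_
  rw [mul_assoc, mul_assoc]
  refine mul_le_mul_of_nonneg_left ?_ (Nat.cast_nonneg _)
  have hcount : ∑ m, (p : Multiset (Fin d)).count m = M := by
    rw [Multiset.sum_count_eq_card fun _ _ => Finset.mem_univ _]
    exact p.2
  have hpow : ρ ^ M = ∏ m, ρ ^ (p : Multiset (Fin d)).count m := by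
    rw [Finset.prod_pow_eq_pow_sum, hcount]
  rw [hpow, ← Finset.prod_mul_distrib, ← Finset.prod_mul_distrib]
  refine Finset.prod_le_prod (fun _ _ => norm_nonneg _) fun m _ => ?_
  set s := (p : Multiset (Fin d)).count m with hs
  have hsM : s ≤ M := by
    rw [← hcount]
    exact Finset.single_le_sum (f := fun m => (p : Multiset (Fin d)).count m)
      (fun _ _ => Nat.zero_le _) (Finset.mem_univ m)
  have hsγ : (s : ℕ∞) ≤ γ := le_trans (by exact_mod_cast hsM) hM
  rw [norm_iteratedFDeriv_eq_norm_iteratedDeriv]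
  have hder : iteratedDeriv s (F m) t = u m ^ s * iteratedDeriv s (q m) (y m + u m * t) := by
    have h1 : ContDiff ℝ s fun z => q m (y m + z) := by
      have h2 : ContDiff ℝ s (q m) := (hq m).1.of_le (by exact_mod_cast hsγ)
      exact h2.comp (by fun_prop)
    have h3 := congrFun (iteratedDeriv_comp_const_mul h1 (u m)) t
    rw [iteratedDeriv_comp_const_add] at h3
    exact h3
  rw [hder, norm_mul, norm_pow, Real.norm_eq_abs, Real.norm_eq_abs]
  set z := y m + u m * t with hz
  have hyz : 1 + |y m| ≤ (1 + M) * (1 + |z|) := by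
    have h1 : |y m| ≤ |z| + M := by
      have h2 : y m = z - u m * t := by rw [hz]; ring
      have h3 : |u m * t| ≤ 1 * M := by
        rw [abs_mul, abs_of_nonneg ht.1]
        exact mul_le_mul ((hu' m).trans hah) ht.2 ht.1 zero_le_one
      calc |y m| ≤ |z| + |u m * t| := by rw [h2]; exact abs_sub _ _
        _ ≤ _ := by linarith
    have h4 : 0 ≤ (M : ℝ) * |z| := by positivity
    linarith
  have hqz : |iteratedDeriv s (q m) z| ≤ D m * (1 + M) ^ 2 * ((1 + |y m|) ^ 2)⁻¹ := by
    rw [← div_eq_mul_inv, le_div_iff₀ (by positivity)]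
    calc |iteratedDeriv s (q m) z| * (1 + |y m|) ^ 2
        ≤ |iteratedDeriv s (q m) z| * ((1 + M) * (1 + |z|)) ^ 2 := by gcongr
      _ = (|iteratedDeriv s (q m) z| * (1 + |z|) ^ 2) * (1 + M) ^ 2 := by ring
      _ ≤ D m * (1 + M) ^ 2 := by gcongr; exact hD m s hsM z
  calc |u m| ^ s * |iteratedDeriv s (q m) z|
      ≤ ρ ^ s * (D m * (1 + M) ^ 2 * ((1 + |y m|) ^ 2)⁻¹) := by
        gcongr
        exact hu' m
    _ = _ := by ring

lemma exists_tsum_fwdDiff_prodDil_le (hq : ∀ m, RegularFastDecay γ (q m)) {M : ℕ}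
    (hM : (M : ℕ∞) ≤ γ) : ∃ C : ℝ≥0∞, C ≠ ⊤ ∧ ∀ (a : ℝ) (x h : EuclideanSpace ℝ (Fin d)),
      0 ≤ a → ∑' k, ‖((fwdDiff h)^[M] (prodDil q a k)) x‖ₑ
        ≤ C * min 1 (ENNReal.ofReal (a * ‖h‖) ^ M) := by
  obtain ⟨C, hC0, hC⟩ := exists_abs_fwdDiff_prodDil_le hq hM
  obtain ⟨L, hL, hL'⟩ := exists_tsum_lattice_le d
  obtain ⟨T, hT, hT'⟩ := exists_tsum_prodDil_le fun m => (hq m).fastDecay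
  refine ⟨ENNReal.ofReal C * L + 2 ^ M * T, by finiteness, fun a x h ha => ?_⟩
  rcases le_total (a * ‖h‖) 1 with hah | hah
  · rw [min_eq_right (pow_le_one₀ (zero_le) (ENNReal.ofReal_le_one.2 hah))]
    calc ∑' k, ‖((fwdDiff h)^[M] (prodDil q a k)) x‖ₑ
        ≤ ∑' k : Fin d → ℤ, ENNReal.ofReal C * ENNReal.ofReal (a * ‖h‖) ^ M *
            ENNReal.ofReal (∏ m, ((1 + |a * x m - k m|) ^ 2)⁻¹) := by
          refine ENNReal.tsum_le_tsum fun k => (enorm_le_ofReal (hC a k x h ha hah)).trans ?_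
          rw [ENNReal.ofReal_mul (by positivity), ENNReal.ofReal_mul hC0,
            ENNReal.ofReal_pow (by positivity)]
      _ ≤ ENNReal.ofReal C * ENNReal.ofReal (a * ‖h‖) ^ M * L := by
          rw [ENNReal.tsum_mul_left]
          gcongr
          exact hL' fun m => a * x m
      _ = ENNReal.ofReal C * L * ENNReal.ofReal (a * ‖h‖) ^ M := by ring
      _ ≤ _ := by gcongr; exact le_self_add
  · rw [min_eq_left (one_le_pow₀ (by simpa using hah)), mul_one]
    calc ∑' k, ‖((fwdDiff h)^[M] (prodDil q a k)) x‖ₑ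
        ≤ ∑' k, ∑ n ∈ Finset.range (M + 1),
            ‖(-1 : ℝ) ^ (M - n) * (M.choose n : ℝ)‖ₑ * ‖prodDil q a k (x + n • h)‖ₑ := by
          refine ENNReal.tsum_le_tsum fun k => ?_
          rw [fwdDiff_iter_eq_sum]
          refine (enorm_sum_le _ _).trans (le_of_eq ?_)
          simp_rw [enorm_mul]
      _ = ∑ n ∈ Finset.range (M + 1), ‖(-1 : ℝ) ^ (M - n) * (M.choose n : ℝ)‖ₑ *
            ∑' k, ‖prodDil q a k (x + n • h)‖ₑ := by
          rw [Summable.tsum_finsetSum fun _ _ => ENNReal.summable]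
          simp_rw [ENNReal.tsum_mul_left]
      _ ≤ ∑ n ∈ Finset.range (M + 1), ‖(-1 : ℝ) ^ (M - n) * (M.choose n : ℝ)‖ₑ * T := by
          gcongr
          exact hT' _ _
      _ = 2 ^ M * T := by
          rw [← Finset.sum_mul]
          congr 1
          simp_rw [Real.enorm_eq_ofReal_abs]
          rw [← ENNReal.ofReal_sum_of_nonneg fun _ _ => abs_nonneg _, sum_abs_binomial,
            ENNReal.ofReal_pow (by norm_num), ENNReal.ofReal_ofNat]
      _ ≤ _ := le_add_self

end prodDil

/-! ### Testing a bounded function against a Hilbert basis -/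

section expansion

variable {d : ℕ}

lemma inner_toLp_eq {E : Type*} [MeasurableSpace E] {μ : Measure E} {u : E → ℝ}
    (hu : MemLp u 2 μ) {b : Lp ℝ 2 μ} {e : E → ℝ} (hb : b =ᵐ[μ] e) :
    inner ℝ b (hu.toLp u) = ∫ x, e x * u x ∂μ := by
  rw [L2.inner_def]
  refine integral_congr_ae ?_
  filter_upwards [hb, hu.coeFn_toLp] with x h1 h2
  rw [h1, h2]
  simp [mul_comm]

/-- Parseval's identity extends to the pairing of a bounded function `f` with a function `η`
whose expansion converges absolutely in `L¹`; truncation of `f` reduces to the `L²` case. -/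
lemma enorm_integral_mul_le_tsum {ι : Type*}
    {b : HilbertBasis ι ℝ (Lp ℝ 2 (volume : Measure (EuclideanSpace ℝ (Fin d))))}
    {e : ι → EuclideanSpace ℝ (Fin d) → ℝ} (hb : ∀ n, b n =ᵐ[volume] e n)
    (he : ∀ n, Integrable (e n)) {η f : EuclideanSpace ℝ (Fin d) → ℝ} (hη : MemLp η 2)
    (hη1 : Integrable η) (hf : Continuous f) (hfb : IsBoundedFun f)
    (hsum : ∑' n, ‖∫ x, e n x * η x‖ₑ * ∫⁻ x, ‖e n x‖ₑ ≠ ⊤) :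
    ‖∫ x, f x * η x‖ₑ ≤ ∑' n, ‖∫ x, e n x * η x‖ₑ * ‖∫ x, f x * e n x‖ₑ := by
  obtain ⟨B, hB⟩ := hfb
  set S : ℕ → Set (EuclideanSpace ℝ (Fin d)) := fun m => Metric.closedBall 0 m with hS
  have hSm : ∀ m, MeasurableSet (S m) := fun m => measurableSet_closedBall
  have hpt : ∀ x, ∀ᶠ m in atTop, (S m).indicator f x = f x := by
    intro x
    obtain ⟨N, hN⟩ := exists_nat_ge ‖x‖
    filter_upwards [eventually_ge_atTop N] with m hm
    refine Set.indicator_of_mem ?_ f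
    simp only [hS, mem_closedBall_zero_iff]
    exact hN.trans (by exact_mod_cast hm)
  have hind : ∀ m x, |(S m).indicator f x| ≤ B := by
    intro m x
    by_cases hx : x ∈ S m
    · rw [Set.indicator_of_mem hx]; exact hB x
    · rw [Set.indicator_of_notMem hx, abs_zero]; exact (abs_nonneg _).trans (hB 0)
  have hL2 : ∀ m, MemLp ((S m).indicator f) 2 := by
    intro m
    rw [memLp_indicator_iff_restrict (hSm m)]
    have : IsFiniteMeasure (volume.restrict (S m)) :=
      ⟨by rw [Measure.restrict_apply_univ]; exact measure_closedBall_lt_top⟩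
    exact MemLp.of_bound hf.aestronglyMeasurable B (Eventually.of_forall hB)
  have hlim : ∀ {u : EuclideanSpace ℝ (Fin d) → ℝ}, Integrable u →
      Tendsto (fun m => ∫ x, (S m).indicator f x * u x) atTop (nhds (∫ x, f x * u x)) := by
    intro u hu
    refine tendsto_integral_of_dominated_convergence (fun x => B * |u x|)
      (fun m => ((hf.aestronglyMeasurable.indicator (hSm m)).mul hu.1))
      (hu.abs.const_mul B) (fun m => Eventually.of_forall fun x => ?_)
      (Eventually.of_forall fun x => ?_)
    · rw [norm_mul]
      exact mul_le_mul_of_nonneg_right (hind m x) (abs_nonneg _)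
    · refine tendsto_const_nhds.congr' ?_
      filter_upwards [hpt x] with m hm
      rw [hm]
  have hP : ∀ m, ∫ x, (S m).indicator f x * η x
      = ∑' n, (∫ x, e n x * η x) * ∫ x, (S m).indicator f x * e n x := by
    intro m
    have h1 := b.tsum_inner_mul_inner ((hL2 m).toLp _) (hη.toLp η)
    rw [inner_toLp_eq hη (hL2 m).coeFn_toLp] at h1
    rw [← h1]
    refine tsum_congr fun n => ?_
    rw [real_inner_comm, inner_toLp_eq (hL2 m) (hb n), inner_toLp_eq hη (hb n), mul_comm]
    congr 2; ext x; ring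
  have hsum' : Summable fun n => |∫ x, e n x * η x| * (B * ∫ x, |e n x|) := by
    have h1 : ∀ n, (‖∫ x, e n x * η x‖ₑ * ∫⁻ x, ‖e n x‖ₑ).toReal
        = |∫ x, e n x * η x| * ∫ x, |e n x| := by
      intro n
      rw [ENNReal.toReal_mul, toReal_enorm, Real.norm_eq_abs]
      congr 1
      exact (integral_norm_eq_lintegral_enorm (he n).1).symm
    have h2 := (ENNReal.summable_toReal hsum).mul_left B
    simp_rw [h1] at h2
    refine h2.congr fun n => ?_
    ring
  have hT : Tendsto (fun m => ∑' n, (∫ x, e n x * η x) * ∫ x, (S m).indicator f x * e n x)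
      atTop (nhds (∑' n, (∫ x, e n x * η x) * ∫ x, f x * e n x)) := by
    refine tendsto_tsum_of_dominated_convergence hsum' (fun n => (hlim (he n)).const_mul _)
      (Eventually.of_forall fun m n => ?_)
    rw [norm_mul]
    refine mul_le_mul_of_nonneg_left ?_ (abs_nonneg _)
    rw [← integral_const_mul]
    refine norm_integral_le_of_norm_le ((he n).abs.const_mul B)
      (Eventually.of_forall fun x => ?_)
    rw [norm_mul]
    exact mul_le_mul_of_nonneg_right (hind m x) (abs_nonneg _)
  have hfin := tendsto_nhds_unique (hlim hη1) (by simpa only [hP] using hT)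
  rw [hfin]
  refine enorm_tsum_le_tsum_enorm.trans (le_of_eq (tsum_congr fun n => enorm_mul _ _))

lemma hasCompactSupport_fwdDiff {V : Type*} [TopologicalSpace V] [AddCommGroup V]
    [IsTopologicalAddGroup V] {θ : V → ℝ} (hθ : HasCompactSupport θ) (h : V) (M : ℕ) :
    HasCompactSupport ((fwdDiff h)^[M] θ) := by
  induction M with
  | zero => exact hθ
  | succ M ih =>
    rw [Function.iterate_succ_apply']
    have h1 : HasCompactSupport fun x => ((fwdDiff h)^[M] θ) (x + h) :=
      ih.comp_homeomorph (Homeomorph.addRight h)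
    exact HasCompactSupport.sub h1 ih

/-- Summation by parts for finite differences. -/
lemma integral_fwdDiff_iter_mul {G θ : EuclideanSpace ℝ (Fin d) → ℝ} (hG : Continuous G)
    (hθ : Continuous θ) (hθc : HasCompactSupport θ) (h : EuclideanSpace ℝ (Fin d)) (M : ℕ) :
    ∫ x, ((fwdDiff h)^[M] G) x * θ x = ∫ x, G x * ((fwdDiff (-h))^[M] θ) x := by
  induction M generalizing θ with
  | zero => rfl
  | succ M ih =>
    have hint : ∀ {u v : EuclideanSpace ℝ (Fin d) → ℝ}, Continuous u → Continuous v →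
        HasCompactSupport v → Integrable fun x => u x * v x := fun hu hv hvc =>
      (hu.mul hv).integrable_of_hasCompactSupport hvc.mul_left
    have h1 : HasCompactSupport fun x => θ (x + -h) :=
      hθc.comp_homeomorph (Homeomorph.addRight (-h))
    have hc := continuous_fwdDiff_iter hG h M
    rw [Function.iterate_succ_apply (f := fwdDiff (-h)), ← ih (θ := fwdDiff (-h) θ)
      (continuous_fwdDiff_iter hθ (-h) 1) (hasCompactSupport_fwdDiff hθc (-h) 1),
      Function.iterate_succ_apply']
    simp only [fwdDiff, sub_mul, mul_sub]
    rw [integral_sub (hint (by fun_prop) hθ hθc) (hint hc hθ hθc),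
      integral_sub (hint hc (by fun_prop) h1) (hint hc hθ hθc)]
    congr 1
    rw [← integral_add_right_eq_self (fun x => ((fwdDiff h)^[M] G) x * θ (x + -h)) h]
    simp

/-- A bound for the integrals against test functions gives a pointwise bound. -/
lemma enorm_le_of_forall_integral {G : EuclideanSpace ℝ (Fin d) → ℝ} (hG : Continuous G)
    {R : ℝ≥0∞} (hR : ∀ θ : EuclideanSpace ℝ (Fin d) → ℝ, ContDiff ℝ 1 θ → HasCompactSupport θ →
      ‖∫ x, G x * θ x‖ₑ ≤ R * ∫⁻ x, ‖θ x‖ₑ) (x : EuclideanSpace ℝ (Fin d)) : ‖G x‖ₑ ≤ R := by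
  refine ENNReal.le_of_forall_pos_le_add fun ε hε _ => ?_
  obtain ⟨δ, hδ, hδ'⟩ := Metric.continuous_iff.1 hG x ε hε
  let β : ContDiffBump x := ⟨δ / 2, δ, by positivity, by linarith⟩
  have hβc : Continuous (β.normed volume) := β.continuous_normed
  have hβs : HasCompactSupport (β.normed volume) := β.hasCompactSupport_normed
  have h1 := hR (β.normed volume) (β.contDiff_normed (n := 1)) hβs
  have h2 : ∫⁻ y, ‖β.normed volume y‖ₑ = 1 := by
    rw [← ofReal_integral_norm_eq_lintegral_enorm β.integrable_normed]
    have h3 : ∀ y, ‖β.normed volume y‖ = β.normed volume y := fun y =>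
      Real.norm_of_nonneg (β.nonneg_normed y)
    simp_rw [h3]
    rw [β.integral_normed, ENNReal.ofReal_one]
  rw [h2, mul_one] at h1
  have hi : ∀ {u : EuclideanSpace ℝ (Fin d) → ℝ}, Continuous u →
      Integrable fun y => u y * β.normed volume y := fun hu =>
    (hu.mul hβc).integrable_of_hasCompactSupport hβs.mul_left
  have h4 : G x = (∫ y, G y * β.normed volume y) + ∫ y, (G x - G y) * β.normed volume y := by
    rw [← integral_add (hi hG) (hi (by fun_prop))]
    have h5 : ∀ y, G y * β.normed volume y + (G x - G y) * β.normed volume y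
        = G x * β.normed volume y := fun y => by ring
    simp_rw [h5]
    rw [integral_const_mul, β.integral_normed, mul_one]
  have h6 : ‖∫ y, (G x - G y) * β.normed volume y‖ ≤ ε := by
    have h7 : ∫ y, ε * β.normed volume y = (ε : ℝ) := by
      rw [integral_const_mul, β.integral_normed, mul_one]
    rw [← h7]
    refine norm_integral_le_of_norm_le (β.integrable_normed.const_mul _)
      (Eventually.of_forall fun y => ?_)
    rw [norm_mul, Real.norm_of_nonneg (β.nonneg_normed y)]
    by_cases hy : y ∈ Metric.ball x δ
    · refine mul_le_mul_of_nonneg_right ?_ (β.nonneg_normed y)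
      rw [← dist_eq_norm, dist_comm]
      exact (hδ' y hy).le
    · have h8 : β.normed volume y = 0 := by
        rw [← Function.notMem_support, β.support_normed_eq]
        exact hy
      simp [h8]
  calc ‖G x‖ₑ ≤ ‖∫ y, G y * β.normed volume y‖ₑ +
        ‖∫ y, (G x - G y) * β.normed volume y‖ₑ := by
        conv_lhs => rw [h4]
        exact enorm_add_le _ _
    _ ≤ R + ε := by
        gcongr
        refine (enorm_le_ofReal h6).trans (le_of_eq ?_)
        simp

end expansion

end

section

/-! ### The modulus of smoothness is controlled by the wavelet coefficients -/

variable {d : ℕ} {γ : ℕ∞} {φ ψ : ℝ → ℝ}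

lemma tsum_enorm_integral_mul_le {ι : Type*} [Countable ι]
    {w : ι → EuclideanSpace ℝ (Fin d) → ℝ} (hw : ∀ k, Continuous (w k))
    {θ : EuclideanSpace ℝ (Fin d) → ℝ} (hθ : Continuous θ) {C : ℝ≥0∞}
    (hC : ∀ x, ∑' k, ‖w k x‖ₑ ≤ C) :
    ∑' k, ‖∫ x, w k x * θ x‖ₑ ≤ C * ∫⁻ x, ‖θ x‖ₑ := by
  calc ∑' k, ‖∫ x, w k x * θ x‖ₑ ≤ ∑' k, ∫⁻ x, ‖w k x‖ₑ * ‖θ x‖ₑ := by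
        refine ENNReal.tsum_le_tsum fun k => (enorm_integral_le_lintegral_enorm _).trans ?_
        simp_rw [enorm_mul]
        rfl
    _ = ∫⁻ x, ∑' k, ‖w k x‖ₑ * ‖θ x‖ₑ :=
        (lintegral_tsum fun k => ((hw k).enorm.measurable.mul hθ.enorm.measurable).aemeasurable).symm
    _ ≤ ∫⁻ x, C * ‖θ x‖ₑ := by
        refine lintegral_mono fun x => ?_
        rw [ENNReal.tsum_mul_right]
        exact mul_le_mul_left (hC x) _
    _ = C * ∫⁻ x, ‖θ x‖ₑ := lintegral_const_mul _ hθ.enorm.measurable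

lemma lintegral_enorm_prodDil {q : Fin d → ℝ → ℝ} (hq : ∀ m, FastDecay (q m)) {a : ℝ}
    (ha : 0 < a) (k : Fin d → ℤ) :
    ∫⁻ x, ‖prodDil q a k x‖ₑ = ENNReal.ofReal ((a ^ d)⁻¹ * ∏ m, ∫ t, |q m t|) := by
  rw [← ofReal_integral_norm_eq_lintegral_enorm (integrable_prodDil hq ha k),
    ← integral_abs_prodDil ha k]
  rfl

lemma enorm_sqrt_mul_self (j : ℕ) :
    ‖√((2 : ℝ) ^ (d * j))‖ₑ * ‖√((2 : ℝ) ^ (d * j))‖ₑ = ENNReal.ofReal (2 ^ (d * j)) := by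
  rw [← enorm_mul, Real.mul_self_sqrt (by positivity), Real.enorm_of_nonneg (by positivity)]

lemma IsWaveletBasis.integrable_waveletFun (hW : IsWaveletBasis d γ φ ψ) (i : Fin d → Bool)
    (j : ℕ) (k : Fin d → ℤ) : Integrable (waveletFun φ ψ i j k) := by
  rw [waveletFun_eq]
  exact integrable_prodDil (hW.fastDecay_factor i) (by positivity) k

lemma IsWaveletBasis.continuous_waveletFun (hW : IsWaveletBasis d γ φ ψ) (i : Fin d → Bool)
    (j : ℕ) (k : Fin d → ℤ) : Continuous (waveletFun φ ψ i j k) := by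
  rw [waveletFun_eq]
  exact continuous_prodDil (hW.fastDecay_factor i) _ k

lemma IsWaveletBasis.lintegral_waveletFun (hW : IsWaveletBasis d γ φ ψ) (i : Fin d → Bool)
    (j : ℕ) (k : Fin d → ℤ) : ENNReal.ofReal (2 ^ (d * j)) * ∫⁻ x, ‖waveletFun φ ψ i j k x‖ₑ
      = ENNReal.ofReal (∏ m, ∫ t, |factor φ ψ i m t|) := by
  rw [waveletFun_eq, lintegral_enorm_prodDil (hW.fastDecay_factor i) (by positivity),
    ← ENNReal.ofReal_mul (by positivity), ← pow_mul, mul_comm j d, ← mul_assoc,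
    mul_inv_cancel₀ (by positivity), one_mul]

/-- The cancellation of the wavelets gives a gain of `2⁻ʲ` for the coefficients of a test
function, by one integration by parts. -/
lemma IsWaveletBasis.exists_tsum_integral_waveletFun_le (hW : IsWaveletBasis d γ φ ψ)
    (hd : 0 < d) (hγ : 1 ≤ γ) (i : WType d) {η : EuclideanSpace ℝ (Fin d) → ℝ}
    (hη : ContDiff ℝ 1 η) (hηc : HasCompactSupport η) : ∃ C : ℝ≥0∞, C ≠ ⊤ ∧ ∀ j : ℕ,
      ∑' k, ‖∫ x, waveletFun φ ψ i.1 j k x * η x‖ₑ ≤ C * (2⁻¹) ^ j := by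
  obtain ⟨m, q, hq0, hqd', hq'⟩ :=
    hW.exists_tensor_primitives hd (M := 1) (by exact_mod_cast hγ) i
  have hqd := hqd' 1 le_rfl
  obtain ⟨T, hT, hT'⟩ := exists_tsum_prodDil_le hqd
  set e : EuclideanSpace ℝ (Fin d) := EuclideanSpace.single m 1 with he
  have hη'c : Continuous fun x => fderiv ℝ η x e :=
    (hη.continuous_fderiv (by norm_num)).clm_apply continuous_const
  have hη's : HasCompactSupport fun x => fderiv ℝ η x e := hηc.fderiv_apply ℝ e
  refine ⟨T * ∫⁻ x, ‖fderiv ℝ η x e‖ₑ, ENNReal.mul_ne_top hT ?_, fun j => ?_⟩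
  · exact (hη'c.integrable_of_hasCompactSupport hη's).2.ne
  have hj : (0 : ℝ) < 2 ^ j := by positivity
  have hibp : ∀ k, ∫ x, waveletFun φ ψ i.1 j k x * η x
      = -(((2 : ℝ) ^ j)⁻¹ * ∫ x, prodDil (q 1) (2 ^ j) k x * fderiv ℝ η x e) := by
    intro k
    have hwc := hW.continuous_waveletFun i.1 j k
    have hpc := continuous_prodDil hqd (2 ^ j) k
    have hint : ∀ {u v : EuclideanSpace ℝ (Fin d) → ℝ}, Continuous u → Continuous v →
        HasCompactSupport u → Integrable fun x => u x * v x := fun hu hv huc =>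
      (hu.mul hv).integrable_of_hasCompactSupport huc.mul_right
    have hv : ((2 : ℝ) ^ j)⁻¹ • e = EuclideanSpace.single m ((2 : ℝ) ^ j)⁻¹ := by
      rw [he]; ext n; simp [PiLp.single_apply]
    have h1 := integral_bilinear_hasLineDerivAt_right_eq_neg_left_of_integrable
      (μ := (volume : Measure (EuclideanSpace ℝ (Fin d)))) (B := ContinuousLinearMap.mul ℝ ℝ)
      (f := η) (f' := fun x => fderiv ℝ η x (((2 : ℝ) ^ j)⁻¹ • e))
      (g := prodDil (q 1) (2 ^ j) k) (g' := waveletFun φ ψ i.1 j k)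
      (v := ((2 : ℝ) ^ j)⁻¹ • e)
      (by
        simp only [map_smul, smul_eq_mul, ContinuousLinearMap.mul_apply', mul_assoc]
        exact (hint hη'c hpc hη's).const_mul _)
      (hint hη.continuous hwc hηc) (hint hη.continuous hpc hηc)
      (fun x _ => ((hη.differentiable (by norm_num)) x).hasFDerivAt.hasLineDerivAt _)
      (fun x _ => by
        have h2 := hq' 0 one_pos _ hj k x 0
        rw [hq0, ← waveletFun_eq, zero_smul, add_zero, ← hv] at h2
        exact h2)
    simp only [ContinuousLinearMap.mul_apply', map_smul, smul_eq_mul, mul_assoc] at h1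
    rw [integral_const_mul] at h1
    simp_rw [mul_comm _ (η _)]
    rw [h1]
    simp_rw [mul_comm (prodDil _ _ _ _)]
  calc ∑' k, ‖∫ x, waveletFun φ ψ i.1 j k x * η x‖ₑ
      = ∑' k, (2⁻¹) ^ j * ‖∫ x, prodDil (q 1) (2 ^ j) k x * fderiv ℝ η x e‖ₑ := by
        refine tsum_congr fun k => ?_
        rw [hibp, enorm_neg, enorm_mul, Real.enorm_of_nonneg (by positivity),
          ENNReal.ofReal_inv_of_pos hj, ENNReal.ofReal_pow (by norm_num), ENNReal.ofReal_ofNat,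
          ENNReal.inv_pow]
    _ ≤ (2⁻¹) ^ j * (T * ∫⁻ x, ‖fderiv ℝ η x e‖ₑ) := by
        rw [ENNReal.tsum_mul_left]
        gcongr
        exact tsum_enorm_integral_mul_le (fun k => continuous_prodDil hqd _ k) hη'c
          fun x => hT' _ x
    _ = _ := mul_comm _ _

lemma tsum_waveletIndex (F : (Fin d → ℤ) ⊕ (WType d × ℕ × (Fin d → ℤ)) → ℝ≥0∞) :
    ∑' n, F n = (∑' k, F (Sum.inl k)) + ∑ i, ∑' j, ∑' k, F (Sum.inr (i, j, k)) := by
  rw [Summable.tsum_sum ENNReal.summable ENNReal.summable]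
  congr 1
  rw [ENNReal.tsum_prod', tsum_fintype]
  exact Finset.sum_congr rfl fun i _ => ENNReal.tsum_prod'

/-- The wavelet expansion of a test function converges absolutely in `L¹`. -/
lemma IsWaveletBasis.tsum_ne_top (hW : IsWaveletBasis d γ φ ψ) (hd : 0 < d) (hγ : 1 ≤ γ)
    {η : EuclideanSpace ℝ (Fin d) → ℝ} (hη : ContDiff ℝ 1 η) (hηc : HasCompactSupport η) :
    ∑' n, ‖∫ x, waveletSystem d φ ψ n x * η x‖ₑ * ∫⁻ x, ‖waveletSystem d φ ψ n x‖ₑ ≠ ⊤ := by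
  rw [tsum_waveletIndex]
  refine ENNReal.add_ne_top.2 ⟨?_, ENNReal.sum_ne_top.2 fun i _ => ?_⟩
  · obtain ⟨T, hT, hT'⟩ := exists_tsum_prodDil_le (hW.fastDecay_factor fun _ => false)
    simp only [waveletSystem]
    have h1 : ∀ k, ∫⁻ x, ‖waveletFun φ ψ (fun _ : Fin d => false) 0 k x‖ₑ
        = ENNReal.ofReal (∏ m, ∫ t, |factor φ ψ (fun _ : Fin d => false) m t|) := fun k => by
      simpa using hW.lintegral_waveletFun (fun _ => false) 0 k
    simp_rw [h1]
    rw [ENNReal.tsum_mul_right]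
    refine ENNReal.mul_ne_top (ne_top_of_le_ne_top (ENNReal.mul_ne_top hT
      (hη.continuous.integrable_of_hasCompactSupport hηc).2.ne)
      (tsum_enorm_integral_mul_le (fun k => hW.continuous_waveletFun _ 0 k) hη.continuous
        fun x => ?_)) ENNReal.ofReal_ne_top
    simp_rw [waveletFun_eq]
    exact hT' _ x
  · obtain ⟨C, hC, hC'⟩ := hW.exists_tsum_integral_waveletFun_le hd hγ i hη hηc
    have h1 : ∀ (j : ℕ) (k : Fin d → ℤ),
        ‖∫ x, waveletSystem d φ ψ (Sum.inr (i, j, k)) x * η x‖ₑ *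
          ∫⁻ x, ‖waveletSystem d φ ψ (Sum.inr (i, j, k)) x‖ₑ
        = ‖∫ x, waveletFun φ ψ i.1 j k x * η x‖ₑ *
          ENNReal.ofReal (∏ m, ∫ t, |factor φ ψ i.1 m t|) := by
      intro j k
      simp only [waveletSystem, mul_assoc, enorm_mul]
      rw [integral_const_mul,
        lintegral_const_mul _ (hW.continuous_waveletFun _ _ _).enorm.measurable, enorm_mul, ← hW.lintegral_waveletFun i.1 j k, ← enorm_sqrt_mul_self]
      ring
    simp_rw [h1, ENNReal.tsum_mul_right]
    refine ENNReal.mul_ne_top (ne_top_of_le_ne_top ?_ (ENNReal.tsum_le_tsum hC'))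
      ENNReal.ofReal_ne_top
    rw [ENNReal.tsum_mul_left, ENNReal.tsum_geometric]
    exact ENNReal.mul_ne_top hC (by simp)

/-- Differences of order `M` of a bounded continuous function in terms of its coefficients: those
at scale `j` contribute `min(1, (2ʲ‖h‖)^M)` times their supremum, the low frequency part
contributes `‖h‖^M`. -/
lemma IsWaveletBasis.exists_enorm_fwdDiff_le (hW : IsWaveletBasis d γ φ ψ) (hd : 0 < d) {M : ℕ}
    (hM0 : 0 < M) (hM : (M : ℕ∞) ≤ γ) {f : EuclideanSpace ℝ (Fin d) → ℝ}
    (hf : Continuous f) (hfb : IsBoundedFun f) : ∃ C : ℝ≥0∞, C ≠ ⊤ ∧ ∀ h x,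
      ‖((fwdDiff h)^[M] f) x‖ₑ ≤ C * (ENNReal.ofReal ‖h‖ ^ M +
        ∑' j : ℕ, min 1 (ENNReal.ofReal (2 ^ j * ‖h‖) ^ M) * coeffSup φ ψ f j) := by
  have hγ : 1 ≤ γ := le_trans (by exact_mod_cast hM0) hM
  obtain ⟨b, hb⟩ := hW.basis
  obtain ⟨B, hB⟩ := id hfb
  choose C hC hC' using fun i : Fin d → Bool =>
    exists_tsum_fwdDiff_prodDil_le (hW.regular_factor i) hM
  set N := ENNReal.ofReal (∏ m, ∫ t, |factor φ ψ (fun _ : Fin d => false) m t|) with hN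
  set Cs : ℝ≥0∞ := C (fun _ => false) * (ENNReal.ofReal B * N) + ∑ i : WType d, C i.1 with hCs
  have hCs' : Cs ≠ ⊤ := by
    refine ENNReal.add_ne_top.2 ⟨ENNReal.mul_ne_top (hC _) (ENNReal.mul_ne_top
      ENNReal.ofReal_ne_top ENNReal.ofReal_ne_top), ENNReal.sum_ne_top.2 fun i _ => hC _⟩
  refine ⟨Cs, hCs', fun h x => enorm_le_of_forall_integral (continuous_fwdDiff_iter hf h M)
    (fun θ hθ hθc => ?_) x⟩
  set I := ∫⁻ x, ‖θ x‖ₑ with hI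
  have hshift : ∀ (F : EuclideanSpace ℝ (Fin d) → ℝ), Continuous F →
      ∫ x, F x * ((fwdDiff (-h))^[M] θ) x = ∫ x, ((fwdDiff h)^[M] F) x * θ x := fun F hF =>
    (integral_fwdDiff_iter_mul hF hθ.continuous hθc h M).symm
  set η := (fwdDiff (-h))^[M] θ with hη
  have hη1 : ContDiff ℝ 1 η := by
    have : η = fun x => _ := funext fun x => fwdDiff_iter_eq_sum θ (-h) M x
    rw [this]
    exact ContDiff.sum fun n _ => contDiff_const.mul (hθ.comp (by fun_prop))
  have hηc : HasCompactSupport η := hasCompactSupport_fwdDiff hθc (-h) M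
  have hsysc : ∀ n, Continuous (waveletSystem d φ ψ n) := by
    rintro (k | ⟨i, j, k⟩)
    · exact hW.continuous_waveletFun _ _ _
    · exact continuous_const.mul (hW.continuous_waveletFun _ _ _)
  have hsysi : ∀ n, Integrable (waveletSystem d φ ψ n) := by
    rintro (k | ⟨i, j, k⟩)
    · exact hW.integrable_waveletFun _ _ _
    · exact (hW.integrable_waveletFun _ _ _).const_mul _
  have hkey := enorm_integral_mul_le_tsum hb hsysi
    (hη1.continuous.memLp_of_hasCompactSupport hηc)
    (hη1.continuous.integrable_of_hasCompactSupport hηc) hf hfb (hW.tsum_ne_top hd hγ hη1 hηc)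
  rw [hshift f hf, tsum_waveletIndex] at hkey
  -- moving the difference onto the wavelets makes the sum over `k` small
  have hscale : ∀ (i : Fin d → Bool) (j : ℕ),
      ∑' k, ‖∫ x, waveletFun φ ψ i j k x * η x‖ₑ
        ≤ C i * min 1 (ENNReal.ofReal (2 ^ j * ‖h‖) ^ M) * I := by
    intro i j
    simp_rw [hshift _ (hW.continuous_waveletFun i j _), waveletFun_eq]
    exact tsum_enorm_integral_mul_le (fun k => continuous_fwdDiff_iter
      (continuous_prodDil (hW.fastDecay_factor i) _ k) h M) hθ.continuous
      fun x => hC' i _ x h (by positivity)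
  have hlow : ∑' k, ‖∫ x, waveletSystem d φ ψ (Sum.inl k) x * η x‖ₑ *
      ‖∫ x, f x * waveletSystem d φ ψ (Sum.inl k) x‖ₑ
      ≤ C (fun _ => false) * (ENNReal.ofReal B * N) * ENNReal.ofReal ‖h‖ ^ M * I := by
    have h1 : ∀ k, ‖∫ x, f x * waveletSystem d φ ψ (Sum.inl k) x‖ₑ ≤ ENNReal.ofReal B * N := by
      intro k
      have h2 := hW.lintegral_waveletFun (fun _ => false) 0 k
      rw [mul_zero, pow_zero, ENNReal.ofReal_one, one_mul] at h2
      rw [hN, ← h2, ← lintegral_const_mul _ (hW.continuous_waveletFun _ _ _).enorm.measurable]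
      refine (enorm_integral_le_lintegral_enorm _).trans (lintegral_mono fun x => ?_)
      rw [enorm_mul]
      exact mul_le_mul_left (enorm_le_ofReal (hB x)) _
    calc _ ≤ ∑' k, ‖∫ x, waveletFun φ ψ (fun _ : Fin d => false) 0 k x * η x‖ₑ *
          (ENNReal.ofReal B * N) := ENNReal.tsum_le_tsum fun k => mul_le_mul_right (h1 k) _
      _ ≤ (C (fun _ => false) * min 1 (ENNReal.ofReal (2 ^ 0 * ‖h‖) ^ M) * I) *
          (ENNReal.ofReal B * N) := by
          rw [ENNReal.tsum_mul_right]
          exact mul_le_mul_left (hscale _ 0) _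
      _ ≤ (C (fun _ => false) * ENNReal.ofReal ‖h‖ ^ M * I) * (ENNReal.ofReal B * N) := by
          gcongr
          rw [pow_zero, one_mul]
          exact min_le_right _ _
      _ = _ := by ring
  have hhigh : ∀ i : WType d, ∑' j, ∑' k,
      ‖∫ x, waveletSystem d φ ψ (Sum.inr (i, j, k)) x * η x‖ₑ *
      ‖∫ x, f x * waveletSystem d φ ψ (Sum.inr (i, j, k)) x‖ₑ
      ≤ C i.1 * (∑' j : ℕ, min 1 (ENNReal.ofReal (2 ^ j * ‖h‖) ^ M) * coeffSup φ ψ f j) * I := by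
    intro i
    rw [mul_assoc, ← ENNReal.tsum_mul_right, ← ENNReal.tsum_mul_left]
    refine ENNReal.tsum_le_tsum fun j => ?_
    have h1 : ∀ k, ‖∫ x, waveletSystem d φ ψ (Sum.inr (i, j, k)) x * η x‖ₑ *
        ‖∫ x, f x * waveletSystem d φ ψ (Sum.inr (i, j, k)) x‖ₑ
        = ‖∫ x, waveletFun φ ψ i.1 j k x * η x‖ₑ * ‖coeff φ ψ f i j k‖ₑ := by
      intro k
      simp only [waveletSystem, mul_assoc, mul_left_comm (f _)]
      rw [integral_const_mul, integral_const_mul, coeff, enorm_mul, enorm_mul, enorm_mul,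
        Real.enorm_of_nonneg (by positivity : (0 : ℝ) ≤ 2 ^ (d * j)), ← enorm_sqrt_mul_self]
      ring
    simp_rw [h1]
    calc _ ≤ ∑' k, ‖∫ x, waveletFun φ ψ i.1 j k x * η x‖ₑ * coeffSup φ ψ f j :=
          ENNReal.tsum_le_tsum fun k => mul_le_mul_right
            (le_iSup₂ (f := fun i k => ‖coeff φ ψ f i j k‖ₑ) i k) _
      _ ≤ (C i.1 * min 1 (ENNReal.ofReal (2 ^ j * ‖h‖) ^ M) * I) * coeffSup φ ψ f j := by
          rw [ENNReal.tsum_mul_right]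
          exact mul_le_mul_left (hscale _ j) _
      _ = _ := by ring
  refine hkey.trans ((add_le_add hlow (Finset.sum_le_sum fun i _ => hhigh i)).trans ?_)
  rw [← Finset.sum_mul, ← Finset.sum_mul, ← add_mul]
  gcongr
  rw [mul_add]
  gcongr
  · exact le_self_add
  · exact le_add_self

end

section

/-! ### Marchaud's inequality and uniform Hölder continuity -/

/-- `Δ_{2h}^M = Δ_h^M (2 + Δ_h)^M` differs from `2^M Δ_h^M` by multiples of `Δ_h^{M+1}`. -/
lemma abs_fwdDiff_two_sub_le {V : Type*} [AddCommGroup V] (M : ℕ) {g : V → ℝ} {h : V} {K : ℝ}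
    (hK : ∀ x, |((fwdDiff h)^[M + 1] g) x| ≤ K) (x : V) :
    |((fwdDiff (2 • h))^[M] g) x - 2 ^ M * ((fwdDiff h)^[M] g) x| ≤ M * 2 ^ M * K := by
  induction M generalizing g x with
  | zero => simp
  | succ M ih =>
    have hK' : ∀ x, |((fwdDiff h)^[M + 1] (fwdDiff h g)) x| ≤ K := fun x => by
      simpa only [← Function.iterate_succ_apply] using hK x
    have h1 : fwdDiff (2 • h) g = (fun x => fwdDiff h g (x + h)) + fwdDiff h g := by
      ext y
      simp only [fwdDiff, Pi.add_apply, two_nsmul, add_assoc]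
      ring
    have h2 := ih hK' x
    have h3 := ih hK' (x + h)
    rw [Function.iterate_succ_apply, h1, fwdDiff_iter_add, Pi.add_apply, fwdDiff_iter_comp_add,
      Function.iterate_succ_apply]
    have h4 : ((fwdDiff h)^[M] (fwdDiff h g)) (x + h) - ((fwdDiff h)^[M] (fwdDiff h g)) x
        = ((fwdDiff h)^[M + 1] (fwdDiff h g)) x := by
      rw [Function.iterate_succ_apply']; rfl
    have h5 := hK' x
    rw [← h4] at h5
    set A := ((fwdDiff (2 • h))^[M] (fwdDiff h g)) (x + h)
    set A' := ((fwdDiff (2 • h))^[M] (fwdDiff h g)) x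
    set D := ((fwdDiff h)^[M] (fwdDiff h g)) (x + h)
    set D' := ((fwdDiff h)^[M] (fwdDiff h g)) x
    have h6 : A + A' - 2 ^ (M + 1) * D'
        = (A - 2 ^ M * D) + (A' - 2 ^ M * D') + 2 ^ M * (D - D') := by ring
    rw [h6]
    have h7 : |2 ^ M * (D - D')| ≤ 2 ^ M * K := by
      rw [abs_mul, abs_of_nonneg (by positivity)]
      gcongr
    have h8 : 0 ≤ 2 ^ M * K := (abs_nonneg _).trans h7
    calc _ ≤ |A - 2 ^ M * D| + |A' - 2 ^ M * D'| + |2 ^ M * (D - D')| := abs_add_three _ _ _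
      _ ≤ M * 2 ^ M * K + M * 2 ^ M * K + 2 ^ M * K := by gcongr
      _ ≤ ((M + 1 : ℕ) : ℝ) * 2 ^ (M + 1) * K := by
        push_cast
        rw [pow_succ]
        nlinarith

/-- Marchaud: for a bounded function and an exponent `β < 1`, a Hölder bound for the differences
of order `M + 1 ≥ 2` descends to the differences of order `M`. -/
lemma exists_holder_descend {V : Type*} [NormedAddCommGroup V] [NormedSpace ℝ V] {f : V → ℝ}
    {B β K : ℝ} {M : ℕ} (hM : 0 < M) (hB : ∀ x, |f x| ≤ B) (hβ : β < 1)
    (hK : ∀ h x, |((fwdDiff h)^[M + 1] f) x| ≤ K * ‖h‖ ^ β) :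
    ∃ K' : ℝ, ∀ h x, |((fwdDiff h)^[M] f) x| ≤ K' * ‖h‖ ^ β := by
  have h2β : (2 : ℝ) ^ β < 2 := by
    simpa using Real.rpow_lt_rpow_of_exponent_lt (by norm_num : (1 : ℝ) < 2) hβ
  -- the fixed point of `K' ↦ 2 ^ (β - 1) * K' + M * |K|`
  set K' : ℝ := M * |K| / (1 - 2 ^ β / 2) with hK'
  have hfix : 2 ^ β / 2 * K' + M * |K| = K' := by
    have h3 : 1 - (2 : ℝ) ^ β / 2 ≠ 0 := by linarith
    have h4 : K' * (1 - 2 ^ β / 2) = M * |K| := div_mul_cancel₀ _ h3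
    linarith
  have hK'0 : 0 ≤ K' := div_nonneg (by positivity) (by linarith)
  have hstep : ∀ (n : ℕ) (h x : V),
      |((fwdDiff h)^[M] f) x| ≤ (1 / 2) ^ n * (2 ^ M * B) + K' * ‖h‖ ^ β := by
    intro n
    induction n with
    | zero =>
      intro h x
      have := abs_fwdDiff_iter_le hB h M x
      have h3 : 0 ≤ K' * ‖h‖ ^ β := by positivity
      simpa using this.trans (le_add_of_nonneg_right h3)
    | succ n ih =>
      intro h x
      have h3 := abs_fwdDiff_two_sub_le M (hK h) x
      have h4 := ih (2 • h) x
      have h5 : ‖(2 : ℕ) • h‖ ^ β = 2 ^ β * ‖h‖ ^ β := by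
        rw [← Nat.cast_smul_eq_nsmul ℝ, norm_smul, Real.mul_rpow (norm_nonneg _) (norm_nonneg _)]
        simp
      rw [h5] at h4
      have h6 : K * ‖h‖ ^ β ≤ |K| * ‖h‖ ^ β := by gcongr; exact le_abs_self K
      set D := ((fwdDiff h)^[M] f) x
      set D₂ := ((fwdDiff (2 • h))^[M] f) x
      set E := (1 / 2 : ℝ) ^ n * (2 ^ M * B) + K' * (2 ^ β * ‖h‖ ^ β)
      have h7 : 2 ^ M * |D| ≤ E + M * 2 ^ M * (|K| * ‖h‖ ^ β) := by
        have h8 : 2 ^ M * |D| = |2 ^ M * D| := by rw [abs_mul, abs_of_nonneg (by positivity : (0 : ℝ) ≤ 2 ^ M)]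
        rw [h8]
        calc |2 ^ M * D| = |D₂ - (D₂ - 2 ^ M * D)| := by rw [sub_sub_cancel]
          _ ≤ |D₂| + |D₂ - 2 ^ M * D| := abs_sub _ _
          _ ≤ E + M * 2 ^ M * (K * ‖h‖ ^ β) := add_le_add h4 h3
          _ ≤ _ := by gcongr
      have hE : 0 ≤ E := (abs_nonneg _).trans h4
      have h9 : E ≤ 2 ^ M * (E / 2) := by
        have h10 : (2 : ℝ) ≤ 2 ^ M := by
          simpa using pow_le_pow_right₀ (by norm_num : (1 : ℝ) ≤ 2) hM
        nlinarith
      have h11 : 2 ^ M * |D| ≤ 2 ^ M * (E / 2 + M * (|K| * ‖h‖ ^ β)) := by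
        calc _ ≤ _ := h7
          _ ≤ 2 ^ M * (E / 2) + M * 2 ^ M * (|K| * ‖h‖ ^ β) := by gcongr
          _ = _ := by ring
      refine (le_of_mul_le_mul_left h11 (by positivity)).trans (le_of_eq ?_)
      calc E / 2 + M * (|K| * ‖h‖ ^ β)
          = (1 / 2 : ℝ) ^ (n + 1) * (2 ^ M * B) + (2 ^ β / 2 * K' + M * |K|) * ‖h‖ ^ β := by
            rw [pow_succ]; ring
        _ = _ := by rw [hfix]
  refine ⟨K', fun h x => ?_⟩
  have hlim : Tendsto (fun n : ℕ => (1 / 2 : ℝ) ^ n * (2 ^ M * B) + K' * ‖h‖ ^ β) atTop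
      (nhds (0 * (2 ^ M * B) + K' * ‖h‖ ^ β)) :=
    ((tendsto_pow_atTop_nhds_zero_of_lt_one (by norm_num) (by norm_num)).mul_const _).add_const _
  rw [zero_mul, zero_add] at hlim
  exact ge_of_tendsto' hlim fun n => hstep n h x

variable {d : ℕ} {f : EuclideanSpace ℝ (Fin d) → ℝ}

/-- A uniformly Hölderian function is Hölder continuous in the sense of first differences. -/
lemma UniformlyHolderian.exists_holder (hf : UniformlyHolderian f) :
    IsBoundedFun f ∧ ∃ β K : ℝ, 0 < β ∧ 0 ≤ K ∧ ∀ h x, |f (x + h) - f x| ≤ K * ‖h‖ ^ β := by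
  obtain ⟨α, hα, hfb, C, R, hC, hR, hm⟩ := hf
  refine ⟨hfb, ?_⟩
  obtain ⟨B, hB⟩ := id hfb
  have hB0 : 0 ≤ B := (abs_nonneg _).trans (hB 0)
  -- lowering the exponent below `1` allows the descent to first differences
  set β := min α (1 / 2) with hβ
  have hβ0 : 0 < β := by positivity
  have hβ1 : β < 1 := (min_le_right _ _).trans_lt (by norm_num)
  set R' := min R 1 with hR'
  have hR'0 : 0 < R' := by positivity
  have hdesc : ∀ M : ℕ, (∃ K : ℝ, ∀ h x, |((fwdDiff h)^[M + 1] f) x| ≤ K * ‖h‖ ^ β) →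
      ∃ K : ℝ, ∀ h x, |((fwdDiff h)^[1] f) x| ≤ K * ‖h‖ ^ β := by
    intro M
    induction M with
    | zero => exact id
    | succ M ih => exact fun ⟨K, hK⟩ => ih (exists_holder_descend M.succ_pos hB hβ1 hK)
  obtain ⟨K, hK⟩ := hdesc ⌊α⌋₊ ⟨C + 2 ^ (⌊α⌋₊ + 1) * B / R' ^ β, fun h x => by
    rcases eq_or_ne h 0 with rfl | hh
    · have h1 : ((fwdDiff (0 : EuclideanSpace ℝ (Fin d)))^[⌊α⌋₊ + 1] f) x = 0 := by
        rw [Function.iterate_succ_apply']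
        simp [fwdDiff]
      rw [h1, abs_zero]
      positivity
    have hh0 : 0 < ‖h‖ := norm_pos_iff.2 hh
    rw [add_mul]
    rcases le_total ‖h‖ R' with hhR | hhR
    · have h1 := (enorm_fwdDiff_le_modulus (⌊α⌋₊ + 1) f le_rfl x).trans
        (hm ‖h‖ hh0 (hhR.trans (min_le_left _ _)))
      have h2 := abs_le_toReal_of_enorm_le ENNReal.ofReal_ne_top h1
      rw [ENNReal.toReal_ofReal (by positivity)] at h2
      refine h2.trans (le_add_of_le_of_nonneg ?_ (by positivity))
      exact mul_le_mul_of_nonneg_left (Real.rpow_le_rpow_of_exponent_ge hh0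
        (hhR.trans (min_le_right _ _)) (min_le_left _ _)) hC.le
    · refine (abs_fwdDiff_iter_le hB h _ x).trans (le_add_of_nonneg_of_le (by positivity) ?_)
      rw [div_mul_eq_mul_div, le_div_iff₀ (by positivity)]
      gcongr⟩
  refine ⟨β, |K|, hβ0, abs_nonneg K, fun h x => (hK h x).trans ?_⟩
  gcongr
  exact le_abs_self K

lemma continuous_of_holder {β K : ℝ} (hβ : 0 < β)
    (h : ∀ h x, |f (x + h) - f x| ≤ K * ‖h‖ ^ β) : Continuous f := by
  refine continuous_iff_continuousAt.2 fun x => ?_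
  rw [ContinuousAt, tendsto_iff_norm_sub_tendsto_zero]
  have h1 : Tendsto (fun y => K * ‖y - x‖ ^ β) (nhds x) (nhds 0) := by
    have h2 : Continuous fun y : EuclideanSpace ℝ (Fin d) => K * ‖y - x‖ ^ β :=
      continuous_const.mul ((by fun_prop : Continuous fun y => ‖y - x‖).rpow_const
        fun _ => Or.inr hβ.le)
    simpa [Real.zero_rpow hβ.ne'] using h2.tendsto x
  refine squeeze_zero (fun _ => norm_nonneg _) (fun y => ?_) h1
  simpa using h (y - x) x

/-! ### Exponential rates and logarithms -/

lemma log2_mono : Monotone log2 := fun _ _ h =>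
  EReal.monotone_div_right_of_nonneg (by exact_mod_cast Real.log_nonneg one_le_two)
    (ENNReal.log_monotone h)

lemma log2_div_anti (j : ℕ) : Antitone fun X => log2 X / (-(j : EReal)) := fun _ _ h =>
  EReal.antitone_div_right_of_nonpos (by simp) (log2_mono h)

lemma log2_two_rpow_div {j : ℕ} (hj : 0 < j) (a : ℝ) :
    log2 (ENNReal.ofReal (2 ^ (-(a * j)))) / (-(j : EReal)) = a := by
  have h2 : Real.log 2 ≠ 0 := (Real.log_pos one_lt_two).ne'
  have hj' : (j : ℝ) ≠ 0 := by positivity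
  have h1 : (-(j : EReal)) = ((-(j : ℝ) : ℝ) : EReal) := by simp
  rw [log2, ENNReal.log_ofReal_of_pos (by positivity), Real.log_rpow two_pos, h1,
    ← EReal.coe_div, ← EReal.coe_div]
  congr 1
  field_simp

lemma inv_two_pow_rpow (j : ℕ) (a : ℝ) : ((2 ^ j : ℝ)⁻¹) ^ a = 2 ^ (-(a * j)) := by
  rw [← Real.rpow_natCast, ← Real.rpow_neg zero_le_two, ← Real.rpow_mul zero_le_two]
  congr 1; ring

lemma eventually_add_lt_rpow {a α μ : ℝ} (ha : α < a) (hμ : α < μ) (A B : ℝ) {c : ℝ}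
    (hc : 0 < c) : ∀ᶠ j : ℕ in atTop,
      A * j * 2 ^ (-(a * j)) + B * 2 ^ (-(μ * j)) < c * (2 : ℝ) ^ (-(α * j)) := by
  have hr : ∀ {s : ℝ}, 0 < s → (2 : ℝ) ^ (-s) < 1 := fun hs =>
    Real.rpow_lt_one_of_one_lt_of_neg one_lt_two (neg_neg_iff_pos.2 hs)
  have h1 := (tendsto_self_mul_const_pow_of_lt_one (r := (2 : ℝ) ^ (-(a - α)))
    (by positivity) (hr (sub_pos.2 ha))).const_mul A
  have h2 := (tendsto_pow_atTop_nhds_zero_of_lt_one (r := (2 : ℝ) ^ (-(μ - α)))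
    (by positivity) (hr (sub_pos.2 hμ))).const_mul B
  have h3 := h1.add h2
  rw [mul_zero, mul_zero, add_zero] at h3
  filter_upwards [h3.eventually_lt_const hc] with j hj
  have h4 : ∀ s : ℝ, (2 : ℝ) ^ (-(s * j)) = ((2 : ℝ) ^ (-(s - α))) ^ j * 2 ^ (-(α * j)) := by
    intro s
    rw [← Real.rpow_natCast, ← Real.rpow_mul zero_le_two, ← Real.rpow_add two_pos]
    congr 1; ring
  rw [h4 a, h4 μ]
  have h5 : (0 : ℝ) < 2 ^ (-(α * j)) := by positivity
  calc _ = (A * (j * ((2 : ℝ) ^ (-(a - α))) ^ j) + B * ((2 : ℝ) ^ (-(μ - α))) ^ j) *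
        2 ^ (-(α * j)) := by ring
    _ < _ := mul_lt_mul_of_pos_right hj h5

end

section

/-! ### Rates of decay of the coefficients and of the modulus of smoothness -/

variable {d : ℕ} {γ : ℕ∞} {φ ψ : ℝ → ℝ} {f : EuclideanSpace ℝ (Fin d) → ℝ}

lemma le_coeffMax_of_ge {M j l : ℕ} (h : j ≤ l) : coeffSup φ ψ f l ≤ coeffMax φ ψ f M j :=
  (le_iSup₂ (f := fun l (_ : j ≤ l) => coeffSup φ ψ f l) l h).trans (le_max_left _ _)

lemma mul_le_coeffMax_of_le {M j l : ℕ} (h : l ≤ j) :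
    ENNReal.ofReal (2 ^ l * (2 ^ j)⁻¹) ^ M * coeffSup φ ψ f l ≤ coeffMax φ ψ f M j := by
  refine le_trans (le_of_eq ?_) ((mul_le_mul_right (le_iSup₂
    (f := fun l (_ : l ≤ j) => (2 : ℝ≥0∞) ^ (l * M) * coeffSup φ ψ f l) l h) _).trans
    (le_max_right _ _))
  rw [ENNReal.ofReal_mul (by positivity), ENNReal.ofReal_inv_of_pos (by positivity),
    ENNReal.ofReal_pow (by norm_num), ENNReal.ofReal_pow (by norm_num), ENNReal.ofReal_ofNat,
    mul_pow, ← ENNReal.inv_pow, ← pow_mul, ← pow_mul]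
  ring

/-- Scales finer than `2⁻ʲ` are handled by monotonicity of the modulus, coarser ones by its
growth `ω^M(2^s r) ≤ 2^{sM} ω^M(r)`. -/
lemma IsWaveletBasis.exists_coeffMax_le (hW : IsWaveletBasis d γ φ ψ) (hd : 0 < d) {M : ℕ}
    (hM0 : 0 < M) (hM : (M : ℕ∞) ≤ γ) (hfb : IsBoundedFun f) (hf : Continuous f) :
    ∃ C : ℝ≥0∞, C ≠ ⊤ ∧ ∀ j : ℕ, coeffMax φ ψ f M j ≤ C * modulus M f ((2 ^ j)⁻¹) := by
  obtain ⟨C, hC, h⟩ := hW.exists_coeffSup_le hd hM0 hM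
  refine ⟨C, hC, fun j => max_le (iSup₂_le fun l hl => ?_) ?_⟩
  · refine (h f hfb hf l).trans (mul_le_mul_right (modulus_mono M f ?_) _)
    gcongr
    norm_num
  · rw [ENNReal.inv_mul_le_iff (by positivity) (by finiteness)]
    refine iSup₂_le fun l hl => ?_
    obtain ⟨s, rfl⟩ := Nat.exists_eq_add_of_le hl
    have h1 := modulus_nat_mul_le hfb M (n := 2 ^ s) (by positivity) (((2 : ℝ) ^ (l + s))⁻¹)
    have h2 : ((2 ^ s : ℕ) : ℝ) * ((2 : ℝ) ^ (l + s))⁻¹ = (2 ^ l)⁻¹ := by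
      push_cast
      rw [pow_add]
      field_simp
    rw [h2] at h1
    push_cast at h1
    calc (2 : ℝ≥0∞) ^ (l * M) * coeffSup φ ψ f l
        ≤ 2 ^ (l * M) * (C * ((2 ^ s) ^ M * modulus M f (((2 : ℝ) ^ (l + s))⁻¹))) := by
          gcongr
          exact (h f hfb hf l).trans (by gcongr)
      _ = _ := by rw [add_mul, pow_add 2 (l * M), pow_mul 2 s M]; ring

/-- Up to a factor linear in `j` and a remainder `O(2^{-jM})`, the modulus of smoothness at `2⁻ʲ`
is at most `coeffMax`. The contribution of the scales `l ≥ J j` goes into the remainder by the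
uniform Hölder regularity; the other scales are `J j` in number, and each is at most `coeffMax`. -/
lemma IsWaveletBasis.exists_modulus_le (hW : IsWaveletBasis d γ φ ψ) (hd : 0 < d) {M : ℕ}
    (hM0 : 0 < M) (hM : (M : ℕ∞) ≤ γ) (hf : UniformlyHolderian f) :
    ∃ A B : ℝ, 0 ≤ A ∧ 0 ≤ B ∧ ∀ j : ℕ, modulus M f ((2 ^ j)⁻¹) ≤
      ENNReal.ofReal (A * j) * coeffMax φ ψ f M j +
        ENNReal.ofReal (B * 2 ^ (-((M : ℝ) * j))) := by
  obtain ⟨hfb, β, K, hβ, hK, hH⟩ := hf.exists_holder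
  have hfc := continuous_of_holder hβ hH
  obtain ⟨C, hC, hC'⟩ := hW.exists_enorm_fwdDiff_le hd hM0 hM hfc hfb
  obtain ⟨D, hD, hD'⟩ := hW.exists_coeffSup_le hd one_pos
    (show ((1 : ℕ) : ℕ∞) ≤ γ from le_trans (by exact_mod_cast hM0) hM)
  have hcoef : ∀ l : ℕ, coeffSup φ ψ f l
      ≤ D * ENNReal.ofReal K * ENNReal.ofReal ((2 : ℝ) ^ (-β)) ^ l := by
    intro l
    refine (hD' f hfb hfc l).trans ?_
    rw [mul_assoc]
    gcongr
    refine modulus_le fun h hh x => ?_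
    rw [← ENNReal.ofReal_pow (by positivity), ← ENNReal.ofReal_mul hK]
    refine enorm_le_ofReal ((hH h x).trans ?_)
    gcongr
    rw [← Real.rpow_natCast, ← Real.rpow_mul zero_le_two, neg_mul, ← inv_two_pow_rpow]
    exact Real.rpow_le_rpow (norm_nonneg _) hh hβ.le
  set r : ℝ≥0∞ := ENNReal.ofReal ((2 : ℝ) ^ (-β)) with hr
  have hr1 : r < 1 := by
    rw [hr, ENNReal.ofReal_lt_one]
    exact Real.rpow_lt_one_of_one_lt_of_neg one_lt_two (neg_neg_iff_pos.2 hβ)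
  -- this choice of `J` gives `r ^ (J j) ≤ 2 ^ (-M j)`
  obtain ⟨J, hJ⟩ := exists_nat_ge ((M : ℝ) / β)
  rw [div_le_iff₀ hβ] at hJ
  set T : ℝ≥0∞ := D * ENNReal.ofReal K * (1 - r)⁻¹ with hT
  have hT' : T ≠ ⊤ := by
    refine ENNReal.mul_ne_top (ENNReal.mul_ne_top hD ENNReal.ofReal_ne_top) ?_
    exact ENNReal.inv_ne_top.2 (tsub_pos_of_lt hr1).ne'
  have hpow : ∀ j : ℕ, ENNReal.ofReal ((2 ^ j : ℝ)⁻¹) ^ M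
      = ENNReal.ofReal (2 ^ (-((M : ℝ) * j))) := by
    intro j
    rw [← ENNReal.ofReal_pow (by positivity), ← Real.rpow_natCast, inv_two_pow_rpow]
  refine ⟨C.toReal * J, (C * (1 + T)).toReal, by positivity, by positivity, fun j => ?_⟩
  set X := coeffMax φ ψ f M j with hX
  have hterm : ∀ l, min 1 (ENNReal.ofReal (2 ^ l * (2 ^ j)⁻¹) ^ M) * coeffSup φ ψ f l ≤ X := by
    intro l
    rcases le_total l j with h | h
    · exact (mul_le_mul_left (min_le_right _ _) _).trans (mul_le_coeffMax_of_le h)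
    · refine (mul_le_mul_left (min_le_left _ _) _).trans ?_
      rw [one_mul]
      exact le_coeffMax_of_ge h
  have hsum : ∑' l : ℕ, min 1 (ENNReal.ofReal (2 ^ l * (2 ^ j)⁻¹) ^ M) * coeffSup φ ψ f l
      ≤ (J * j : ℕ) * X + T * ENNReal.ofReal (2 ^ (-((M : ℝ) * j))) := by
    rw [← Summable.sum_add_tsum_nat_add' (k := J * j) ENNReal.summable]
    refine add_le_add ?_ ?_
    · refine (Finset.sum_le_sum fun l _ => hterm l).trans ?_
      rw [Finset.sum_const, Finset.card_range, nsmul_eq_mul]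
    · have hrJ : r ^ (J * j) ≤ ENNReal.ofReal (2 ^ (-((M : ℝ) * j))) := by
        rw [hr, ← ENNReal.ofReal_pow (by positivity)]
        refine ENNReal.ofReal_le_ofReal ?_
        rw [← Real.rpow_natCast, ← Real.rpow_mul zero_le_two]
        refine Real.rpow_le_rpow_of_exponent_le one_le_two ?_
        have h1 := mul_le_mul_of_nonneg_right hJ (Nat.cast_nonneg (α := ℝ) j)
        push_cast
        linarith
      calc _ ≤ ∑' l : ℕ, D * ENNReal.ofReal K * r ^ (J * j) * r ^ l := by
            refine ENNReal.tsum_le_tsum fun l => ?_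
            refine (mul_le_mul_left (min_le_left _ _) _).trans ?_
            rw [one_mul, mul_assoc, ← pow_add, add_comm (J * j)]
            exact hcoef _
        _ = T * r ^ (J * j) := by
            rw [ENNReal.tsum_mul_left, ENNReal.tsum_geometric, hT]
            ring
        _ ≤ _ := by gcongr
  have hmod : modulus M f ((2 ^ j)⁻¹) ≤ C * (ENNReal.ofReal ((2 ^ j : ℝ)⁻¹) ^ M +
      ((J * j : ℕ) * X + T * ENNReal.ofReal (2 ^ (-((M : ℝ) * j))))) := by
    refine modulus_le fun h hh x => (hC' h x).trans ?_
    gcongr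
    refine le_trans (ENNReal.tsum_le_tsum fun l => ?_) hsum
    gcongr
  refine hmod.trans (le_of_eq ?_)
  rw [hpow, ENNReal.ofReal_mul ENNReal.toReal_nonneg, ENNReal.ofReal_toReal (by finiteness),
    mul_assoc C.toReal, ENNReal.ofReal_mul ENNReal.toReal_nonneg, ENNReal.ofReal_toReal hC]
  have h1 : ENNReal.ofReal ((J : ℝ) * j) = ((J * j : ℕ) : ℝ≥0∞) := by
    rw [← ENNReal.ofReal_natCast]; push_cast; rfl
  rw [h1]
  ring

/-- If `f ∈ UI^α` with `α < M`, the rate of decay of the coefficients is eventually below any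
`a > α`. -/
lemma IsWaveletBasis.eventually_rate_le (hW : IsWaveletBasis d γ φ ψ) (hd : 0 < d) {M : ℕ}
    (hM : (M : ℕ∞) ≤ γ) (hf : UniformlyHolderian f) {α a : ℝ} (hα : MemUI α f)
    (hαM : ⌊α⌋₊ + 1 = M) (ha : α < a) :
    ∀ᶠ j : ℕ in atTop, log2 (coeffMax φ ψ f M j) / (-(j : EReal)) ≤ a := by
  obtain ⟨hfb, c, R, hc, hR, hUI⟩ := hα
  rw [hαM] at hUI
  have hαM' : α < M := by
    rw [← hαM]; push_cast; exact Nat.lt_floor_add_one α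
  obtain ⟨A, B, hA, hB, hmod⟩ := hW.exists_modulus_le hd (by omega) hM hf
  have hlim : Tendsto (fun j : ℕ => ((2 : ℝ) ^ j)⁻¹) atTop (nhds 0) := by
    simpa using tendsto_pow_atTop_nhds_zero_of_lt_one (r := (2 : ℝ)⁻¹) (by norm_num) (by norm_num)
  filter_upwards [eventually_add_lt_rpow ha hαM' A B hc, hlim.eventually_le_const hR,
    eventually_gt_atTop 0] with j hj hjR hj0
  rw [← log2_two_rpow_div hj0 a]
  refine log2_div_anti j ?_
  by_contra! hlt
  have h1 := (hUI _ (by positivity) hjR).trans (hmod j)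
  have h2 : ENNReal.ofReal (c * ((2 ^ j : ℝ)⁻¹) ^ α) ≤
      ENNReal.ofReal (A * j * 2 ^ (-(a * j)) + B * 2 ^ (-((M : ℝ) * j))) := by
    rw [ENNReal.ofReal_add (by positivity) (by positivity),
      ENNReal.ofReal_mul (p := A * j) (by positivity)]
    exact h1.trans (by gcongr)
  rw [ENNReal.ofReal_le_ofReal_iff (by positivity), inv_two_pow_rpow] at h2
  exact absurd h2 (not_le.2 hj)

lemma eventually_le_rate {X : ℕ → ℝ≥0∞} {C a α : ℝ} (ha : a < α) :
    ∀ᶠ j : ℕ in atTop, X j ≤ ENNReal.ofReal (C * 2 ^ (-(α * j))) →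
      (a : EReal) ≤ log2 (X j) / (-(j : EReal)) := by
  filter_upwards [eventually_add_lt_rpow (a := a + 1) (by linarith) ha 0 C one_pos,
    eventually_gt_atTop 0] with j hj hj0 hX
  rw [← log2_two_rpow_div hj0 a]
  refine log2_div_anti j (hX.trans (ENNReal.ofReal_le_ofReal ?_))
  linarith

/-- If `f ∉ UI^α`, the rate of decay of the coefficients exceeds any `a < α` infinitely often. -/
lemma IsWaveletBasis.frequently_le_rate (hW : IsWaveletBasis d γ φ ψ) (hd : 0 < d) {M : ℕ}
    (hM : (M : ℕ∞) ≤ γ) (hfb : IsBoundedFun f) (hf : Continuous f) {α a : ℝ} (hα0 : 0 ≤ α)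
    (hα : ¬ MemUI α f) (hαM : ⌊α⌋₊ + 1 ≤ M) (ha : a < α) :
    ∃ᶠ j : ℕ in atTop, (a : EReal) ≤ log2 (coeffMax φ ψ f M j) / (-(j : EReal)) := by
  obtain ⟨C, hC, hC'⟩ := hW.exists_coeffMax_le hd (by omega) hM hfb hf
  obtain ⟨s, rfl⟩ := Nat.exists_eq_add_of_le hαM
  set D : ℝ≥0∞ := C * 2 ^ s with hD
  have hD' : D ≠ ⊤ := by finiteness
  have hfreq : ∃ᶠ j : ℕ in atTop, coeffMax φ ψ f (⌊α⌋₊ + 1 + s) j ≤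
      ENNReal.ofReal (D.toReal * 2 ^ α * 2 ^ (-(α * j))) := by
    rw [frequently_atTop]
    intro N
    have h1 : ∃ r : ℝ, 0 < r ∧ r ≤ (1 / 2) ^ N ∧
        modulus (⌊α⌋₊ + 1) f r < ENNReal.ofReal (1 * r ^ α) := by
      by_contra! h
      exact hα ⟨hfb, 1, (1 / 2) ^ N, one_pos, by positivity, h⟩
    obtain ⟨r, hr0, hrN, hr⟩ := h1
    obtain ⟨n, hn1, hn2⟩ := exists_nat_pow_near_of_lt_one hr0
      (hrN.trans (pow_le_one₀ (by norm_num) (by norm_num))) (by norm_num : (0 : ℝ) < 1 / 2)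
      (by norm_num)
    have hNn : N ≤ n + 1 := by
      by_contra! h
      exact absurd (hn1.trans_le hrN) (not_lt.2
        (pow_le_pow_of_le_one (by norm_num) (by norm_num) h.le))
    -- the dyadic scale `2^{-(n+1)} < r ≤ 2^{-n}`
    refine ⟨n + 1, hNn, ?_⟩
    have h2 : ((2 : ℝ) ^ (n + 1))⁻¹ ≤ r := by
      rw [← inv_pow, ← one_div]; exact hn1.le
    calc coeffMax φ ψ f (⌊α⌋₊ + 1 + s) (n + 1)
        ≤ C * modulus (⌊α⌋₊ + 1 + s) f ((2 ^ (n + 1))⁻¹) := hC' _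
      _ ≤ C * (2 ^ s * modulus (⌊α⌋₊ + 1) f r) := by
          gcongr
          exact (modulus_add_le hfb _ s _).trans (by gcongr; exact modulus_mono _ _ h2)
      _ ≤ C * (2 ^ s * ENNReal.ofReal (2 ^ α * 2 ^ (-(α * (n + 1 : ℕ))))) := by
          gcongr
          refine hr.le.trans (ENNReal.ofReal_le_ofReal ?_)
          have h3 : (2 : ℝ) ^ α * 2 ^ (-(α * (n + 1 : ℕ))) = ((1 / 2 : ℝ) ^ n) ^ α := by
            rw [one_div, inv_pow, inv_two_pow_rpow, ← Real.rpow_add two_pos]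
            congr 1; push_cast; ring
          rw [one_mul, h3]
          exact Real.rpow_le_rpow hr0.le hn2 hα0
      _ = _ := by
          rw [mul_assoc D.toReal, ENNReal.ofReal_mul ENNReal.toReal_nonneg,
            ENNReal.ofReal_toReal hD', hD, mul_assoc]
  exact (hfreq.and_eventually (eventually_le_rate ha)).mono fun j hj => hj.2 hj.1

lemma IsWaveletBasis.eventually_neg_le_rate (hW : IsWaveletBasis d γ φ ψ) (hd : 0 < d) {M : ℕ}
    (hM0 : 0 < M) (hM : (M : ℕ∞) ≤ γ) (hfb : IsBoundedFun f) (hf : Continuous f) {a : ℝ}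
    (ha : a < 0) :
    ∀ᶠ j : ℕ in atTop, (a : EReal) ≤ log2 (coeffMax φ ψ f M j) / (-(j : EReal)) := by
  obtain ⟨C, hC, hC'⟩ := hW.exists_coeffMax_le hd hM0 hM hfb hf
  set D := C * modulus M f 1 with hD
  have hD' : D ≠ ⊤ := ENNReal.mul_ne_top hC (modulus_ne_top hfb M 1)
  refine (eventually_le_rate (C := D.toReal) ha).mono fun j hj => hj ?_
  rw [zero_mul, neg_zero, Real.rpow_zero, mul_one, ENNReal.ofReal_toReal hD']
  refine (hC' j).trans (mul_le_mul_right (modulus_mono M f ?_) _)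
  exact inv_le_one_of_one_le₀ (one_le_pow₀ one_le_two)

lemma upperExponent_le {α : ℝ} (hα0 : 0 ≤ α) (hα : MemUI α f) : upperExponent f ≤ α :=
  iInf₂_le (f := fun (α : ℝ) (_ : 0 ≤ α ∧ MemUI α f) => (α : EReal)) α ⟨hα0, hα⟩

lemma upperExponent_nonneg (f : EuclideanSpace ℝ (Fin d) → ℝ) : 0 ≤ upperExponent f :=
  le_iInf₂ fun _ h => by exact_mod_cast h.1

end

end UpperHolder

end

open UpperHolder in
theorem corollary4 {d : ℕ} (hd : 0 < d) (γ : ℕ∞) (φ ψ : ℝ → ℝ)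
    (hW : UpperHolder.IsWaveletBasis d γ φ ψ)
    (f : EuclideanSpace ℝ (Fin d) → ℝ) (hf : UpperHolder.UniformlyHolderian f) :
    (∀ M : ℕ, UpperHolder.upperExponent f ≠ ⊤ →
      M = ⌊(UpperHolder.upperExponent f).toReal⌋₊ + 1 → (M : ℕ∞) ≤ γ →
      UpperHolder.upperExponent f =
        limsup (fun j : ℕ => UpperHolder.log2 (UpperHolder.coeffMax φ ψ f M j) / (-(j : EReal)))
          atTop) ∧
    (UpperHolder.upperExponent f = ⊤ → γ = ⊤ →
      limsup (fun j : ℕ =>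
          UpperHolder.log2 (⨆ (l : ℕ) (_ : j ≤ l), UpperHolder.coeffSup φ ψ f l) / (-(j : EReal)))
        atTop = ⊤) := by
  obtain ⟨hfb, β, K, hβ, -, hH⟩ := hf.exists_holder
  have hfc := continuous_of_holder hβ hH
  refine ⟨fun M hfin hM hMγ => ?_, fun htop hγ => ?_⟩
  · obtain ⟨H, hHe⟩ : ∃ H : ℝ, upperExponent f = H :=
      ⟨_, (EReal.coe_toReal hfin (ne_bot_of_le_ne_bot (by simp) (upperExponent_nonneg f))).symm⟩
    rw [hHe, EReal.toReal_coe] at hM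
    have hH0 : 0 ≤ H := by
      have := upperExponent_nonneg f
      rw [hHe] at this
      exact_mod_cast this
    refine le_antisymm ?_ ?_
    · rw [← EReal.ge_of_forall_gt_iff_ge]
      intro a ha
      rw [hHe] at ha
      have ha' : a < H := by exact_mod_cast ha
      refine le_limsup_of_frequently_le ?_
      rcases lt_or_ge a 0 with ha0 | ha0
      · exact (hW.eventually_neg_le_rate hd (by omega) hMγ hfb hfc ha0).frequently
      · obtain ⟨α, haα, hαH⟩ := exists_between ha'
        have hα0 : 0 ≤ α := ha0.trans haα.le
        refine hW.frequently_le_rate hd hMγ hfb hfc hα0 (fun hUI => ?_) ?_ haα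
        · have := upperExponent_le hα0 hUI
          rw [hHe] at this
          exact absurd hαH (not_lt.2 (by exact_mod_cast this))
        · rw [hM]
          gcongr
    · rw [← EReal.le_of_forall_lt_iff_le]
      intro a ha
      have hHM : H < M := by
        rw [hM]; push_cast; exact Nat.lt_floor_add_one H
      have hlt : upperExponent f < ((min a M : ℝ) : EReal) := by
        rw [hHe] at ha ⊢
        exact_mod_cast lt_min (by exact_mod_cast ha) hHM
      -- an exponent `α` in `[H, min a M)` with `f ∈ UI^α`, which has the same order `M` as `H`
      obtain ⟨α, hα⟩ := iInf_lt_iff.1 hlt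
      obtain ⟨⟨hα0, hUI⟩, hαlt⟩ := iInf_lt_iff.1 hα
      have hαlt' : α < min a M := by exact_mod_cast hαlt
      have hHα : H ≤ α := by
        have := upperExponent_le hα0 hUI
        rw [hHe] at this
        exact_mod_cast this
      have hfl : ⌊α⌋₊ + 1 = M := by
        have h1 : ⌊H⌋₊ ≤ ⌊α⌋₊ := Nat.floor_mono hHα
        have h2 : ⌊α⌋₊ < M := (Nat.floor_lt hα0).2 (hαlt'.trans_le (min_le_right _ _))
        omega
      exact limsup_le_of_le (h := hW.eventually_rate_le hd hMγ hf hUI hfl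
        (hαlt'.trans_le (min_le_left _ _)))
  · rw [EReal.eq_top_iff_forall_lt]
    intro a
    -- `f` belongs to no `UI^α`; any nonnegative `α > a + 1` will do
    set α : ℝ := max a 0 + 2 with hα
    have hα0 : 0 ≤ α := by positivity
    have hUI : ¬ MemUI α f := fun h => by
      have := upperExponent_le hα0 h
      rw [htop] at this
      exact absurd this (by simp)
    have haα : a + 1 < α := by linarith [le_max_left a 0]
    have h1 := hW.frequently_le_rate hd (M := ⌊α⌋₊ + 1) (by rw [hγ]; exact le_top) hfb hfc hα0 hUI
      le_rfl haα
    refine lt_of_lt_of_le (b := ((a + 1 : ℝ) : EReal)) (by exact_mod_cast lt_add_one a)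
      (le_limsup_of_frequently_le (h1.mono fun j hj => hj.trans ?_))
    exact log2_div_anti j (le_max_left _ _)
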